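/- **Setting.** Let $I=\{1,\dots,n\}$ be the vertex set of a connected graph with symmetric weights $\omega_{ij}$, positive on edges and $0$ otherwise. For $a\in\mathbb R^n$ let $L(a)$ be the weighted Laplacian matrix, $(L(a)\Phi)_i=\sum_j\omega_{ij}(\Phi_i-\Phi_j)\frac{a_i+a_j}{2}$, with pseudo-inverse $L(a)^\dagger$. Equip the open simplex $\mathcal P_+(I)=\{q\in\mathbb R^n: q_i>0,\ \sum_i q_i=1\}$ with the Riemannian metric $g^W_q(\sigma,\tau)=\sigma^{\mathsf T}L(q)^\dagger\tau$ on $T_q\mathcal P_+(I)=\{\sigma:\sum_i\sigma_i=0\}$, and let $\nabla^W$ be its Levi-Civita connection. Let $U\subseteq\mathbb R^d$ be open, let $p:U\to\mathcal P_+(I)$ be smooth with Jacobi matrix $J_\theta p(\theta)$ of rank $d$ everywhere, and let $G(\theta)=J_\theta p(\theta)^{\mathsf T}L(p(\theta))^\dagger J_\theta p(\theta)$ be the matrix of the pulled back metric $g$. Let $\Theta\subseteq U$ be contained in the closure of its interior (for instance $\Theta$ open, or a compact set which is the closure of its interior, such as a compact box). Let $$\operatorname{Dist}(\theta_0,\theta_1)^2=\inf\int_0^1\dot\theta_t^{\mathsf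 T}G(\theta_t)\dot\theta_t\,dt,$$ the infimum being over $C^1$ curves $[0,1]\to\Theta$ from $\theta_0$ to $\theta_1$. A *constant speed geodesic* of $(\Theta,g)$ is a curve $\theta:[0,1]\to\Theta$ which solves the geodesic equations $\dot\theta_t=G(\theta_t)^{-1}S_t$, $\dot S_t=-\frac12\partial_\theta\big(S_t^{\mathsf T}G(\theta)^{-1}S_t\big)\big|_{\theta=\theta_t}$ for some $S$ and attains the infimum defining $\operatorname{Dist}(\theta_0,\theta_1)^2$. For $f\in\mathbb R^n$ put $F(p(\theta))=\sum_i f_ip_i(\theta)$. For $\lambda\in\mathbb R$, call $f$ *$\lambda$-convex in $(\Theta,I,p)$* if for every constant speed geodesic $\theta_t$ of $(\Theta,g)$ and all $t\in[0,1]$ $$F(p(\theta_t))\le(1-t)F(p(\theta_0))+tF(p(\theta_1))-\tfrac{\lambda}{2}t(1-t)\operatorname{Dist}(\theta_0,\theta_1)^2 .$$ For $\Phi,\tilde\Phi\in\mathbb R^n$ let $\Gamma(\Phi,\tilde\Phi)_i=\frac12\sum_j\omega_{ij}(\Phi_i-\Phi_j)(\tilde\Phi_i-\tilde\Phi_j)$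 and $V_\Phi=L(p(\theta))\Phi$. Let $B_{p(\theta)}(\sigma,\tau)=(\nabla^W_\sigma\tau)^\perp$, for $\sigma,\tau$ in $T_{p(\theta)}p(\Theta)=\operatorname{range}J_\theta p(\theta)$, be the second fundamental form of the immersion $p$ into $(\mathcal P_+(I),g^W)$ at $\theta$, where $\tau$ is extended to a field along $p$ that is tangent to the model and $\perp$ is the $g^W$-orthogonal component. **Theorem.** For all $f\in\mathbb R^n$ and $\lambda\in\mathbb R$, $f$ is $\lambda$-convex in $(\Theta,I,p)$ if and only if $$\sum_{i=1}^n p_i(\theta)\Big(\Gamma(\Gamma(f,\Phi),\Phi)-\tfrac12\Gamma(\Gamma(\Phi,\Phi),f)\Big)_i+\sum_{i=1}^n f_i\,B_{p(\theta)}(V_\Phi,V_\Phi)_i\ \ge\ \lambda\sum_{i=1}^n\Gamma(\Phi,\Phi)_i\,p_i(\theta)$$ for all $\theta\in\Theta$ and all $\Phi\in\mathbb R^n$ with $V_\Phi\in T_{p(\theta)}p(\Theta)$. -/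

import Mathlib

open scoped Matrix ContDiff

noncomputable section

namespace DiscreteOT

/-- A weighted graph on the sample space `I = Fin n`: the weights are symmetric, positive on
edges and zero elsewhere. -/
structure WeightedGraph (n : ℕ) where
  graph : SimpleGraph (Fin n)
  weight : Fin n → Fin n → ℝ
  weight_symm : ∀ i j, weight i j = weight j i
  weight_pos : ∀ i j, graph.Adj i j → 0 < weight i j
  weight_eq_zero : ∀ i j, ¬ graph.Adj i j → weight i j = 0

/-- The relative interior of the probability simplex, `𝒫₊(I)`. -/
def openSimplex (n : ℕ) : Set (Fin n → ℝ) :=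
  {q | (∀ i, 0 < q i) ∧ ∑ i, q i = 1}

/-- A statistical model on an open parameter set `U ⊆ ℝᵈ`: a smooth parametrization
`p : U → 𝒫₊(I)` whose Jacobi matrix has rank `d` at every point. -/
structure IsStatisticalModel {n d : ℕ} (U : Set (Fin d → ℝ)) (p : (Fin d → ℝ) → (Fin n → ℝ)) :
    Prop where
  isOpen : IsOpen U
  contDiffOn : ContDiffOn ℝ ∞ p U
  mapsTo : Set.MapsTo p U (openSimplex n)
  rank_eq : ∀ θ ∈ U, (LinearMap.toMatrix' (fderiv ℝ p θ : (Fin d → ℝ) →ₗ[ℝ] (Fin n → ℝ))).rank = d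

/-- The Jacobi matrix `J_θ p(θ)`. -/
def jacobian {n d : ℕ} (p : (Fin d → ℝ) → (Fin n → ℝ)) (θ : Fin d → ℝ) :
    Matrix (Fin n) (Fin d) ℝ :=
  LinearMap.toMatrix' (fderiv ℝ p θ : (Fin d → ℝ) →ₗ[ℝ] (Fin n → ℝ))

/-- The tangent space of the image of the model at `p(θ)`: the range of `dp(θ)`. -/
def modelTangentSpace {n d : ℕ} (p : (Fin d → ℝ) → (Fin n → ℝ)) (θ : Fin d → ℝ) :
    Submodule ℝ (Fin n → ℝ) :=
  LinearMap.range (fderiv ℝ p θ : (Fin d → ℝ) →ₗ[ℝ] (Fin n → ℝ))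

/-- The relaxation `F(p(θ)) = ∑ fᵢ pᵢ(θ)`. -/
def relaxation {n d : ℕ} (p : (Fin d → ℝ) → (Fin n → ℝ)) (f : Fin n → ℝ) (θ : Fin d → ℝ) : ℝ :=
  ∑ i, f i * p θ i

namespace WeightedGraph

variable {n d : ℕ} (W : WeightedGraph n)

/-- The discrete Bakry–Émery operator
`Γ(Φ, Ψ)ᵢ = ½ ∑_{j ∈ N(i)} ω_{ij} (Φᵢ - Φⱼ) (Ψᵢ - Ψⱼ)`.
The sum may run over all `j` since `ω_{ij} = 0` unless `j ∈ N(i)`. -/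
def Gam (Φ Ψ : Fin n → ℝ) : Fin n → ℝ :=
  fun i => (1 / 2) * ∑ j, W.weight i j * (Φ i - Φ j) * (Ψ i - Ψ j)

/-- The vector `V_Φ = - div_G (q ∇_G Φ)`. -/
def velocity (q Φ : Fin n → ℝ) : Fin n → ℝ :=
  fun i => ∑ j, W.weight i j * (Φ i - Φ j) * ((q i + q j) / 2)

/-- The weighted Laplacian matrix `L(a)`. -/
def laplacian (a : Fin n → ℝ) : Matrix (Fin n) (Fin n) ℝ :=
  Matrix.diagonal (fun i => ∑ j, W.weight i j * ((a i + a j) / 2)) -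
    Matrix.of (fun i j => W.weight i j * ((a i + a j) / 2))

theorem laplacian_mulVec (q Φ : Fin n → ℝ) : W.laplacian q *ᵥ Φ = W.velocity q Φ := by
  funext i
  simp only [laplacian, velocity, Matrix.sub_mulVec, Pi.sub_apply, Matrix.mulVec_diagonal]
  simp only [Matrix.mulVec, dotProduct, Matrix.of_apply]
  rw [Finset.sum_mul, ← Finset.sum_sub_distrib]
  exact Finset.sum_congr rfl fun j _ => by ring

theorem laplacian_isHermitian (a : Fin n → ℝ) : (W.laplacian a).IsHermitian := by
  refine Matrix.IsHermitian.sub (Matrix.isHermitian_diagonal _) ?_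
  ext i j
  simp [Matrix.conjTranspose_apply, W.weight_symm i j, add_comm]

/-- The pseudo-inverse `L(a)†`: in an orthonormal eigenbasis, each eigenvalue `μ ≠ 0` is replaced
by `μ⁻¹` and the eigenvalue `0` is kept (recall `0⁻¹ = 0`). -/
def laplacianPinv (a : Fin n → ℝ) : Matrix (Fin n) (Fin n) ℝ :=
  (W.laplacian_isHermitian a).cfc (fun μ => μ⁻¹)

/-- The Wasserstein metric `g^W_q(σ, τ) = σᵀ L(q)† τ`. -/
def metric (q σ τ : Fin n → ℝ) : ℝ :=
  σ ⬝ᵥ (W.laplacianPinv q *ᵥ τ)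

/-- The right-hand side of the Koszul formula for constant fields:
`½ (∂_σ g(τ, υ) + ∂_τ g(σ, υ) - ∂_υ g(σ, τ))`. -/
def koszul (q σ τ υ : Fin n → ℝ) : ℝ :=
  (1 / 2) * (fderiv ℝ (fun x => W.metric x τ υ) q σ + fderiv ℝ (fun x => W.metric x σ υ) q τ
    - fderiv ℝ (fun x => W.metric x σ τ) q υ)

/-- The Christoffel symbol of the Levi-Civita connection of `(𝒫₊(I), g^W)`, i.e. the vector
`C(σ, τ)` tangent to the simplex with `g^W_q(C(σ, τ), υ) = koszul q σ τ υ` for all tangent `υ`.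
The matrix `L(q)` raises the index because `L(q)†` represents the metric. -/
def christoffel (q σ τ : Fin n → ℝ) : Fin n → ℝ :=
  W.laplacian q *ᵥ (fun i => W.koszul q σ τ (Pi.single i 1))

/-- The covariant derivative `∇^W_{dp(θ)a} Y` at `p(θ)` of a vector field `Y` of `𝒫₊(I)` along
the parametrization `p`. -/
def covDeriv (p : (Fin d → ℝ) → (Fin n → ℝ)) (θ a : Fin d → ℝ) (Y : (Fin d → ℝ) → (Fin n → ℝ)) :
    Fin n → ℝ :=
  fderiv ℝ Y θ a + W.christoffel (p θ) (jacobian p θ *ᵥ a) (Y θ)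

/-- The pulled back metric tensor `G(θ) = J_θ p(θ)ᵀ L(p(θ))† J_θ p(θ)` on the parameters. -/
def paramMetric (p : (Fin d → ℝ) → (Fin n → ℝ)) (θ : Fin d → ℝ) : Matrix (Fin d) (Fin d) ℝ :=
  (jacobian p θ)ᵀ * W.laplacianPinv (p θ) * jacobian p θ

/-- The parameter coordinates of the `g^W`-orthogonal projection of `σ` to `T_{p(θ)} p(Θ)`;
they satisfy `tangentCoord p θ (J_θ p(θ) a) = a`. -/
def tangentCoord (p : (Fin d → ℝ) → (Fin n → ℝ)) (θ : Fin d → ℝ) (σ : Fin n → ℝ) : Fin d → ℝ :=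
  ((W.paramMetric p θ)⁻¹ * (jacobian p θ)ᵀ * W.laplacianPinv (p θ)) *ᵥ σ

/-- The component `σ^⊥` of `σ` normal to `T_{p(θ)} p(Θ)` with respect to `g^W`. -/
def normalPart (p : (Fin d → ℝ) → (Fin n → ℝ)) (θ : Fin d → ℝ) (σ : Fin n → ℝ) : Fin n → ℝ :=
  σ - jacobian p θ *ᵥ W.tangentCoord p θ σ

/-- The second fundamental form `B_{p(θ)}(σ, τ) = (∇^W_σ τ)^⊥` of `p(Θ)` in `(𝒫₊(I), g^W)`, for
`σ, τ ∈ T_{p(θ)} p(Θ)`. The vector `τ = dp(θ) b` is extended to the field `x ↦ dp(x) b`, which is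
tangent to the model. -/
def secondFundamentalForm (p : (Fin d → ℝ) → (Fin n → ℝ)) (θ : Fin d → ℝ) (σ τ : Fin n → ℝ) :
    Fin n → ℝ :=
  W.normalPart p θ
    (W.covDeriv p θ (W.tangentCoord p θ σ) (fun x => jacobian p x *ᵥ W.tangentCoord p θ τ))

/-- The action `∫₀¹ γ'ᵀ G(γ) γ' dt` of a curve in the parameters. -/
def action (p : (Fin d → ℝ) → (Fin n → ℝ)) (γ : ℝ → (Fin d → ℝ)) : ℝ :=
  ∫ t in (0 : ℝ)..1, derivWithin γ (Set.Icc 0 1) t ⬝ᵥ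
    (W.paramMetric p (γ t) *ᵥ derivWithin γ (Set.Icc 0 1) t)

/-- The squared Riemannian distance `Dist(θ₀, θ₁)²` on `(Θ, g)`: the infimum of the action over
`C¹` curves `[0,1] → Θ` from `θ₀` to `θ₁`. -/
def distSq (p : (Fin d → ℝ) → (Fin n → ℝ)) (Θ : Set (Fin d → ℝ)) (θ₀ θ₁ : Fin d → ℝ) : ℝ :=
  sInf {e | ∃ γ : ℝ → (Fin d → ℝ), ContDiffOn ℝ 1 γ (Set.Icc 0 1) ∧
    Set.MapsTo γ (Set.Icc 0 1) Θ ∧ γ 0 = θ₀ ∧ γ 1 = θ₁ ∧ e = W.action p γ}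

/-- `γ : [0,1] → Θ` solves the (cotangent) geodesic equations of `(Θ, g)`:
`γ' = G(γ)⁻¹ S` and `S' = -½ ∂_θ (Sᵀ G(γ)⁻¹ S)` for some covector field `S` along `γ`.
In particular its speed is constant. -/
def IsGeodesic (p : (Fin d → ℝ) → (Fin n → ℝ)) (Θ : Set (Fin d → ℝ)) (γ : ℝ → (Fin d → ℝ)) :
    Prop :=
  Set.MapsTo γ (Set.Icc 0 1) Θ ∧
    ∃ S : ℝ → (Fin d → ℝ), ∀ t ∈ Set.Icc (0 : ℝ) 1,
      HasDerivWithinAt γ ((W.paramMetric p (γ t))⁻¹ *ᵥ S t) (Set.Icc 0 1) t ∧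
      HasDerivWithinAt S
        (fun k => -(1 / 2) * fderiv ℝ (fun x => S t ⬝ᵥ ((W.paramMetric p x)⁻¹ *ᵥ S t)) (γ t)
          (Pi.single k 1))
        (Set.Icc 0 1) t

/-- A constant speed (minimizing) geodesic of `(Θ, g)`: a solution of the geodesic equations which
attains the infimum defining the distance of its end points. -/
def IsMinimizingGeodesic (p : (Fin d → ℝ) → (Fin n → ℝ)) (Θ : Set (Fin d → ℝ))
    (γ : ℝ → (Fin d → ℝ)) : Prop :=
  W.IsGeodesic p Θ γ ∧ W.action p γ = W.distSq p Θ (γ 0) (γ 1)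

/-- `F : Θ → ℝ` is `lam`-displacement convex on `(Θ, g)`. -/
def IsDisplacementConvex (p : (Fin d → ℝ) → (Fin n → ℝ)) (Θ : Set (Fin d → ℝ)) (lam : ℝ)
    (F : (Fin d → ℝ) → ℝ) : Prop :=
  ∀ γ : ℝ → (Fin d → ℝ), W.IsMinimizingGeodesic p Θ γ → ∀ t ∈ Set.Icc (0 : ℝ) 1,
    F (γ t) ≤ (1 - t) * F (γ 0) + t * F (γ 1)
      - lam / 2 * t * (1 - t) * W.distSq p Θ (γ 0) (γ 1)

end WeightedGraph

end DiscreteOT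

end

open scoped Matrix ContDiff

noncomputable section

namespace DiscreteOT

/-! ### Calculus for matrix-valued functions. -/

section MatrixCalculus

variable {ι κ μ : Type*} [Fintype ι] [Fintype κ] [Fintype μ]
  {E : Type*} [NormedAddCommGroup E] [NormedSpace ℝ E] {s : Set E} {k : ℕ∞ω}

/-! Geodesics of `(Θ, g)` are the base curves of the flow of the Hamiltonian `½ sᵀ G(x)⁻¹ s`, and
both sides of the criterion are read off along this flow. The left side is the second derivative of
the relaxation, `relaxationHess`; the sum on the right is the squared speed, by `paramMetric_self`.

The first claim is `relaxationHess_eq`. A geodesic of the model has ambient covariant acceleration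
normal to the model, equal to `B(V, V)`; its flat acceleration is therefore `B(V, V)` minus the
Christoffel term `C(V, V)`. Differentiating `L(q) L(q)† σ = σ` expresses the derivative of the
metric through `Γ`, and `dotProduct_christoffel` identifies `-f ⬝ C(V, V)` with the Bakry–Émery sum.
By `criterion_iff` the criterion becomes `lam aᵀ G a ≤ relaxationHess` for all `x` and `a`.

Sufficiency (`isDisplacementConvex_of_hess`): energy is conserved, so along a minimizing geodesic
the second derivative is at least `lam` times the squared distance of the end points, and
subtracting the matching parabola leaves a convex function.

Necessity: if the inequality fails at an interior point, it fails along a short geodesic from there,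
and displacement convexity is violated at its midpoint, provided that the short geodesic is
minimizing among all `C¹` curves in `Θ`. This is `exists_minimizing_flow`: `calibration` handles
curves that stay near the starting point, and `le_action_of_exits` shows that the others are too
expensive. Points of `Θ` outside the interior follow by continuity, since `Θ ⊆ closure (interior
Θ)`. -/

theorem contDiffOn_mulVec {M : E → Matrix ι κ ℝ} {v : E → κ → ℝ}
    (hM : ∀ i j, ContDiffOn ℝ k (fun x => M x i j) s) (hv : ContDiffOn ℝ k v s) :
    ContDiffOn ℝ k (fun x => M x *ᵥ v x) s := by
  rw [contDiffOn_pi] at hv ⊢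
  intro i
  simp only [Matrix.mulVec, dotProduct]
  exact ContDiffOn.sum fun j _ => (hM i j).mul (hv j)

theorem contDiffOn_dotProduct {u v : E → κ → ℝ}
    (hu : ContDiffOn ℝ k u s) (hv : ContDiffOn ℝ k v s) :
    ContDiffOn ℝ k (fun x => u x ⬝ᵥ v x) s := by
  rw [contDiffOn_pi] at hu hv
  simp only [dotProduct]
  exact ContDiffOn.sum fun j _ => (hu j).mul (hv j)

omit [Fintype ι] [Fintype μ] in
theorem contDiffOn_matrixMul {M : E → Matrix ι κ ℝ} {N : E → Matrix κ μ ℝ}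
    (hM : ∀ i j, ContDiffOn ℝ k (fun x => M x i j) s)
    (hN : ∀ i j, ContDiffOn ℝ k (fun x => N x i j) s) (i : ι) (j : μ) :
    ContDiffOn ℝ k (fun x => (M x * N x) i j) s := by
  simp only [Matrix.mul_apply]
  exact ContDiffOn.sum fun l _ => (hM i l).mul (hN l j)

theorem contDiffOn_det [DecidableEq ι] {M : E → Matrix ι ι ℝ}
    (hM : ∀ i j, ContDiffOn ℝ k (fun x => M x i j) s) :
    ContDiffOn ℝ k (fun x => (M x).det) s := by
  simp only [Matrix.det_apply]
  exact ContDiffOn.sum fun σ _ => ContDiffOn.const_smul _ (contDiffOn_prod fun i _ => hM _ _)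

theorem contDiffOn_matrixInv [DecidableEq ι] {M : E → Matrix ι ι ℝ}
    (hM : ∀ i j, ContDiffOn ℝ k (fun x => M x i j) s) (hdet : ∀ x ∈ s, (M x).det ≠ 0) (i j : ι) :
    ContDiffOn ℝ k (fun x => (M x)⁻¹ i j) s := by
  have h : ∀ x ∈ s, (M x)⁻¹ i j = ((M x).det)⁻¹ * (M x).adjugate i j := fun x _ => by
    simp [Matrix.inv_def]
  refine ContDiffOn.congr (ContDiffOn.mul ((contDiffOn_det hM).inv hdet) ?_) h
  simp only [Matrix.adjugate_apply]
  refine contDiffOn_det fun a b => ?_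
  by_cases hab : a = j
  · subst hab
    simp only [Matrix.updateRow_self]
    exact contDiffOn_const
  · simp only [Matrix.updateRow_ne hab]
    exact hM a b

omit [Fintype ι] in
theorem hasDerivAt_mulVec {M : ℝ → Matrix ι κ ℝ} {M' : Matrix ι κ ℝ} {v : ℝ → κ → ℝ}
    {v' : κ → ℝ} {t : ℝ} (hM : ∀ i j, HasDerivAt (fun x => M x i j) (M' i j) t)
    (hv : HasDerivAt v v' t) :
    HasDerivAt (fun x => M x *ᵥ v x) (M' *ᵥ v t + M t *ᵥ v') t := by
  rw [hasDerivAt_pi] at hv ⊢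
  intro i
  simp only [Matrix.mulVec, dotProduct, Pi.add_apply, ← Finset.sum_add_distrib]
  exact HasDerivAt.fun_sum fun j _ => (hM i j).mul (hv j)

theorem hasDerivWithinAt_dotProduct {u v : ℝ → κ → ℝ} {u' v' : κ → ℝ} {t : ℝ} {S : Set ℝ}
    (hu : HasDerivWithinAt u u' S t) (hv : HasDerivWithinAt v v' S t) :
    HasDerivWithinAt (fun x => u x ⬝ᵥ v x) (u' ⬝ᵥ v t + u t ⬝ᵥ v') S t := by
  rw [hasDerivWithinAt_pi] at hu hv
  simp only [dotProduct, ← Finset.sum_add_distrib]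
  exact HasDerivWithinAt.fun_sum fun j _ => (hu j).mul (hv j)

theorem hasDerivAt_dotProduct {u v : ℝ → κ → ℝ} {u' v' : κ → ℝ} {t : ℝ}
    (hu : HasDerivAt u u' t) (hv : HasDerivAt v v' t) :
    HasDerivAt (fun x => u x ⬝ᵥ v x) (u' ⬝ᵥ v t + u t ⬝ᵥ v') t := by
  rw [← hasDerivWithinAt_univ] at *
  exact hasDerivWithinAt_dotProduct hu hv

theorem clm_apply_eq_sum [DecidableEq κ] (A : (κ → ℝ) →L[ℝ] ℝ) (b : κ → ℝ) :
    A b = ∑ i, b i * A (Pi.single i 1) := by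
  conv_lhs => rw [← Finset.univ_sum_single b, map_sum]
  refine Finset.sum_congr rfl fun i _ => ?_
  rw [← smul_eq_mul, ← map_smul, ← Pi.single_smul, smul_eq_mul, mul_one]

theorem hasDerivAt_comp_line {F : Type*} [NormedAddCommGroup F] [NormedSpace ℝ F] {f : E → F}
    {x : E} (hf : DifferentiableAt ℝ f x) (v : E) :
    HasDerivAt (fun t : ℝ => f (x + t • v)) (fderiv ℝ f x v) 0 := by
  have h1 : HasDerivAt (fun t : ℝ => x + t • v) v 0 := by
    simpa using ((hasDerivAt_id (0 : ℝ)).smul_const v).const_add x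
  have h2 : HasFDerivAt f (fderiv ℝ f x) (x + (0 : ℝ) • v) := by simpa using hf.hasFDerivAt
  exact h2.comp_hasDerivAt (0 : ℝ) h1

end MatrixCalculus

/-! ### Metric tensors and the Hamiltonian form of the geodesic equations. -/

/-- `G` is a smooth Riemannian metric tensor on the open set `U`. -/
structure IsSmoothMetricOn {d : ℕ} (G : (Fin d → ℝ) → Matrix (Fin d) (Fin d) ℝ)
    (U : Set (Fin d → ℝ)) : Prop where
  isOpen : IsOpen U
  smooth : ∀ i j, ContDiffOn ℝ ∞ (fun x => G x i j) U
  symm : ∀ x ∈ U, (G x)ᵀ = G x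
  pos : ∀ x ∈ U, ∀ a, a ≠ 0 → 0 < a ⬝ᵥ (G x *ᵥ a)

section Hamiltonian

variable {d : ℕ} (G : (Fin d → ℝ) → Matrix (Fin d) (Fin d) ℝ) {U : Set (Fin d → ℝ)}

/-- The Hamiltonian `½ sᵀ G(x)⁻¹ s` of the geodesic flow. -/
def ham (z : (Fin d → ℝ) × (Fin d → ℝ)) : ℝ := 1 / 2 * (z.2 ⬝ᵥ ((G z.1)⁻¹ *ᵥ z.2))

/-- The velocity component `G(x)⁻¹ s` of the Hamiltonian vector field. -/
def hamVel (z : (Fin d → ℝ) × (Fin d → ℝ)) : Fin d → ℝ := (G z.1)⁻¹ *ᵥ z.2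

/-- The momentum component `-½ ∂ₓ (sᵀ G(x)⁻¹ s)` of the Hamiltonian vector field. -/
def hamForce (z : (Fin d → ℝ) × (Fin d → ℝ)) : Fin d → ℝ := fun k =>
  -(1 / 2) * fderiv ℝ (fun x => z.2 ⬝ᵥ ((G x)⁻¹ *ᵥ z.2)) z.1 (Pi.single k 1)

variable {G} (hG : IsSmoothMetricOn G U)

namespace IsSmoothMetricOn
include hG

theorem nonneg {x : Fin d → ℝ} (hx : x ∈ U) (a : Fin d → ℝ) : 0 ≤ a ⬝ᵥ (G x *ᵥ a) := by
  rcases eq_or_ne a 0 with rfl | ha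
  · simp
  · exact (hG.pos x hx a ha).le

theorem dot_comm {x : Fin d → ℝ} (hx : x ∈ U) (a b : Fin d → ℝ) :
    a ⬝ᵥ (G x *ᵥ b) = b ⬝ᵥ (G x *ᵥ a) := by
  rw [Matrix.dotProduct_mulVec, ← Matrix.mulVec_transpose, hG.symm x hx, dotProduct_comm]

theorem det_ne_zero {x : Fin d → ℝ} (hx : x ∈ U) : (G x).det ≠ 0 := by
  intro h
  obtain ⟨v, hv, hv0⟩ := Matrix.exists_mulVec_eq_zero_iff.2 h
  have := hG.pos x hx v hv
  simp [hv0] at this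

theorem mulVec_inv {x : Fin d → ℝ} (hx : x ∈ U) (a : Fin d → ℝ) :
    G x *ᵥ ((G x)⁻¹ *ᵥ a) = a := by
  rw [Matrix.mulVec_mulVec, Matrix.mul_nonsing_inv _ (hG.det_ne_zero hx).isUnit,
    Matrix.one_mulVec]

theorem inv_mulVec {x : Fin d → ℝ} (hx : x ∈ U) (a : Fin d → ℝ) :
    (G x)⁻¹ *ᵥ (G x *ᵥ a) = a := by
  rw [Matrix.mulVec_mulVec, Matrix.nonsing_inv_mul _ (hG.det_ne_zero hx).isUnit,
    Matrix.one_mulVec]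

theorem inv_dot_comm {x : Fin d → ℝ} (hx : x ∈ U) (a b : Fin d → ℝ) :
    a ⬝ᵥ ((G x)⁻¹ *ᵥ b) = b ⬝ᵥ ((G x)⁻¹ *ᵥ a) := by
  have h := hG.dot_comm hx ((G x)⁻¹ *ᵥ a) ((G x)⁻¹ *ᵥ b)
  rw [hG.mulVec_inv hx, hG.mulVec_inv hx] at h
  rw [dotProduct_comm a, dotProduct_comm b]
  exact h.symm ▸ rfl

/-- `s G⁻¹ s + a G a - 2 s a = (a - G⁻¹ s) G (a - G⁻¹ s)`. -/
theorem young_identity {x : Fin d → ℝ} (hx : x ∈ U) (s a : Fin d → ℝ) :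
    s ⬝ᵥ ((G x)⁻¹ *ᵥ s) + a ⬝ᵥ (G x *ᵥ a) - 2 * (s ⬝ᵥ a) =
      (a - (G x)⁻¹ *ᵥ s) ⬝ᵥ (G x *ᵥ (a - (G x)⁻¹ *ᵥ s)) := by
  rw [Matrix.mulVec_sub, hG.mulVec_inv hx, dotProduct_sub, sub_dotProduct, sub_dotProduct,
    hG.dot_comm hx ((G x)⁻¹ *ᵥ s) a, hG.mulVec_inv hx, dotProduct_comm a s,
    dotProduct_comm ((G x)⁻¹ *ᵥ s) s]
  ring

/-- Complete the square with `ε • s` in `young_identity`. The parameter `ε` becomes the duration of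
the geodesic in `calibration`. -/
theorem young {x : Fin d → ℝ} (hx : x ∈ U) (s a : Fin d → ℝ) {ε : ℝ} (hε : 0 < ε) :
    s ⬝ᵥ a ≤ ε * ham G (x, s) + 1 / (2 * ε) * (a ⬝ᵥ (G x *ᵥ a)) := by
  have h := hG.young_identity hx (ε • s) a
  have h' := hG.nonneg hx (a - (G x)⁻¹ *ᵥ (ε • s))
  rw [← h] at h'
  simp only [Matrix.mulVec_smul, dotProduct_smul, smul_dotProduct, smul_eq_mul] at h'
  have : s ⬝ᵥ a ≤ (ε * (ε * (s ⬝ᵥ ((G x)⁻¹ *ᵥ s))) + a ⬝ᵥ (G x *ᵥ a)) / (2 * ε) := by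
    rw [le_div_iff₀ (by positivity)]; linarith
  refine this.trans (le_of_eq ?_)
  simp only [ham]
  field_simp

theorem inv_smooth (i j : Fin d) : ContDiffOn ℝ ∞ (fun x => (G x)⁻¹ i j) U :=
  contDiffOn_matrixInv hG.smooth (fun _ hx => hG.det_ne_zero hx) i j

theorem contDiffOn_hamVel : ContDiffOn ℝ ∞ (hamVel G) (U ×ˢ Set.univ) :=
  contDiffOn_mulVec (fun i j => (hG.inv_smooth i j).comp contDiffOn_fst fun _ hz => hz.1)
    contDiffOn_snd

theorem contDiffOn_ham : ContDiffOn ℝ ∞ (ham G) (U ×ˢ Set.univ) :=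
  contDiffOn_const.mul (contDiffOn_dotProduct contDiffOn_snd hG.contDiffOn_hamVel)

theorem isOpen_prod : IsOpen (U ×ˢ (Set.univ : Set (Fin d → ℝ))) := hG.isOpen.prod isOpen_univ

theorem contDiffAt_ham {z : (Fin d → ℝ) × (Fin d → ℝ)} (hz : z.1 ∈ U) :
    ContDiffAt ℝ ∞ (ham G) z :=
  hG.contDiffOn_ham.contDiffAt (hG.isOpen_prod.mem_nhds ⟨hz, trivial⟩)

theorem differentiableAt_inv_quadratic {x : Fin d → ℝ} (hx : x ∈ U) (s : Fin d → ℝ) :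
    DifferentiableAt ℝ (fun y => s ⬝ᵥ ((G y)⁻¹ *ᵥ s)) x :=
  ((contDiffOn_dotProduct contDiffOn_const
    (contDiffOn_mulVec hG.inv_smooth contDiffOn_const)).contDiffAt
      (hG.isOpen.mem_nhds hx)).differentiableAt (by simp)

omit hG in
theorem _root_.DiscreteOT.hamForce_dotProduct (z : (Fin d → ℝ) × (Fin d → ℝ)) (b : Fin d → ℝ) :
    hamForce G z ⬝ᵥ b =
      -(1 / 2) * fderiv ℝ (fun x => z.2 ⬝ᵥ ((G x)⁻¹ *ᵥ z.2)) z.1 b := by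
  rw [clm_apply_eq_sum, Finset.mul_sum]
  simp only [dotProduct, hamForce]
  exact Finset.sum_congr rfl fun i _ => by ring

theorem fderiv_ham {z : (Fin d → ℝ) × (Fin d → ℝ)} (hz : z.1 ∈ U) (b c : Fin d → ℝ) :
    fderiv ℝ (ham G) z (b, c) = hamVel G z ⬝ᵥ c - hamForce G z ⬝ᵥ b := by
  have hd : DifferentiableAt ℝ (ham G) z := (hG.contDiffAt_ham hz).differentiableAt (by simp)
  have h1 := hasDerivAt_comp_line hd (b, 0)
  have h2 := hasDerivAt_comp_line hd (0, c)
  have e1 := (hasDerivAt_comp_line (hG.differentiableAt_inv_quadratic hz z.2) b).const_mul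
    (1 / 2 : ℝ)
  have h1' : fderiv ℝ (ham G) z (b, 0) = - (hamForce G z ⬝ᵥ b) := by
    rw [hamForce_dotProduct]
    have h : HasDerivAt (fun t : ℝ => 1 / 2 * z.2 ⬝ᵥ (G (z.1 + t • b))⁻¹ *ᵥ z.2)
        (fderiv ℝ (ham G) z (b, 0)) 0 := by
      refine h1.congr_of_eventuallyEq (.of_forall fun t => ?_)
      simp [ham]
    rw [h.unique e1]
    ring
  have e2 : HasDerivAt (fun t : ℝ => z.2 + t • c) c 0 := by
    simpa using ((hasDerivAt_id (0 : ℝ)).smul_const c).const_add z.2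
  have e3 := (hasDerivAt_dotProduct e2 (hasDerivAt_mulVec (M := fun _ => (G z.1)⁻¹) (M' := 0)
    (fun i j => hasDerivAt_const _ _) e2)).const_mul (1 / 2 : ℝ)
  have h2' : fderiv ℝ (ham G) z (0, c) = hamVel G z ⬝ᵥ c := by
    have h : HasDerivAt (fun t : ℝ => 1 / 2 * (z.2 + t • c) ⬝ᵥ (G z.1)⁻¹ *ᵥ (z.2 + t • c))
        (fderiv ℝ (ham G) z (0, c)) 0 := by
      refine h2.congr_of_eventuallyEq (.of_forall fun t => ?_)
      simp [ham]
    rw [h.unique e3]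
    simp only [zero_smul, add_zero, Matrix.zero_mulVec, zero_add, hamVel]
    rw [hG.inv_dot_comm hz z.2 c, dotProduct_comm c]
    ring
  have : ((b, c) : (Fin d → ℝ) × (Fin d → ℝ)) = (b, 0) + (0, c) := by simp
  rw [this, map_add, h1', h2']
  ring

/-- The definition differentiates in `x` with `s` frozen, which hides joint smoothness. Up to sign
each component is a directional derivative of the jointly smooth `ham G`. -/
theorem contDiffOn_hamForce : ContDiffOn ℝ ∞ (hamForce G) (U ×ˢ Set.univ) := by
  rw [contDiffOn_pi]
  intro k
  have h : ContDiffOn ℝ ∞ (fun z => - fderiv ℝ (ham G) z (Pi.single k 1, 0)) (U ×ˢ Set.univ) :=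
    ((hG.contDiffOn_ham.fderiv_of_isOpen hG.isOpen_prod (by simp)).clm_apply contDiffOn_const).neg
  refine h.congr fun z hz => ?_
  rw [hG.fderiv_ham hz.1]
  simp

end IsSmoothMetricOn

end Hamiltonian

/-! ### Short geodesics minimize the action. -/

theorem sq_norm_le_dotProduct {d : ℕ} (y : Fin d → ℝ) : ‖y‖ ^ 2 ≤ y ⬝ᵥ y := by
  have h0 : 0 ≤ y ⬝ᵥ y := Finset.sum_nonneg fun i _ => mul_self_nonneg _
  have : ‖y‖ ≤ Real.sqrt (y ⬝ᵥ y) := by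
    refine (pi_norm_le_iff_of_nonneg (Real.sqrt_nonneg _)).2 fun i => ?_
    rw [Real.norm_eq_abs]
    refine Real.abs_le_sqrt ?_
    rw [sq]
    exact Finset.single_le_sum (f := fun i => y i * y i) (fun i _ => mul_self_nonneg _)
      (Finset.mem_univ i)
  calc ‖y‖ ^ 2 ≤ Real.sqrt (y ⬝ᵥ y) ^ 2 := by gcongr
    _ = y ⬝ᵥ y := Real.sq_sqrt h0

/-- The action `∫₀¹ c'ᵀ G(c) c' dt` of a curve. -/
def metricAction {d : ℕ} (G : (Fin d → ℝ) → Matrix (Fin d) (Fin d) ℝ) (c : ℝ → (Fin d → ℝ)) : ℝ :=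
  ∫ t in (0 : ℝ)..1, derivWithin c (Set.Icc 0 1) t ⬝ᵥ
    (G (c t) *ᵥ derivWithin c (Set.Icc 0 1) t)

namespace IsSmoothMetricOn

variable {d : ℕ} {G : (Fin d → ℝ) → Matrix (Fin d) (Fin d) ℝ} {U : Set (Fin d → ℝ)}
  (hG : IsSmoothMetricOn G U)

include hG

/-- The derivative of `ham G` is `C¹`, hence Lipschitz near `z₀`. The mean value inequality on the
points of the ball within `‖w‖` of `z` then bounds the Taylor remainder, with the Lipschitz constant
as `K`. -/
theorem exists_ham_taylor {z₀ : (Fin d → ℝ) × (Fin d → ℝ)} (hz₀ : z₀.1 ∈ U) :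
    ∃ ρ > 0, ∃ K ≥ 0, Metric.ball z₀ ρ ⊆ U ×ˢ Set.univ ∧
      ∀ z ∈ Metric.ball z₀ ρ, ∀ w, z + w ∈ Metric.ball z₀ ρ →
        ham G (z + w) ≤ ham G z + fderiv ℝ (ham G) z w + K * ‖w‖ ^ 2 := by
  have hC : ContDiffAt ℝ 1 (fderiv ℝ (ham G)) z₀ :=
    ((hG.contDiffAt_ham hz₀).fderiv_right (m := ∞) (by simp)).of_le (by simp)
  obtain ⟨K, t, ht, hL⟩ := hC.exists_lipschitzOnWith
  obtain ⟨ρ, hρ, hball⟩ := Metric.mem_nhds_iff.1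
    (Filter.inter_mem ht (hG.isOpen_prod.mem_nhds ⟨hz₀, trivial⟩))
  refine ⟨ρ, hρ, K, K.2, fun z hz => (hball hz).2, fun z hz w hw => ?_⟩
  have hs : Convex ℝ (Metric.ball z₀ ρ ∩ Metric.closedBall z ‖w‖) :=
    (convex_ball _ _).inter (convex_closedBall _ _)
  have := hs.norm_image_sub_le_of_norm_hasFDerivWithin_le' (f := ham G) (f' := fderiv ℝ (ham G))
    (φ := fderiv ℝ (ham G) z) (C := K * ‖w‖) (x := z) (y := z + w)
    (fun x hx => ((hG.contDiffAt_ham (hball hx.1).2.1).differentiableAt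
      (by simp)).hasFDerivAt.hasFDerivWithinAt)
    (fun x hx => by
      have := hL.norm_sub_le (hball hx.1).1 (hball hz).1
      refine this.trans ?_
      gcongr
      simpa [dist_eq_norm] using hx.2)
    ⟨hz, by simp⟩ ⟨hw, by simp [dist_eq_norm]⟩
  rw [add_sub_cancel_left] at this
  have h2 := (le_abs_self _).trans this
  nlinarith

theorem exists_flow {z₀ : (Fin d → ℝ) × (Fin d → ℝ)} (hz₀ : z₀.1 ∈ U)
    {N : Set ((Fin d → ℝ) × (Fin d → ℝ))} (hN : N ∈ nhds z₀) :
    ∃ δ > 0, ∃ z : ℝ → (Fin d → ℝ) × (Fin d → ℝ), z 0 = z₀ ∧ ∀ t ∈ Set.Ioo (-δ) δ,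
      HasDerivAt z (hamVel G (z t), hamForce G (z t)) t ∧ z t ∈ N := by
  have hC : ContDiffAt ℝ 1 (fun z => (hamVel G z, hamForce G z)) z₀ :=
    ((hG.contDiffOn_hamVel.prodMk hG.contDiffOn_hamForce).contDiffAt
      (hG.isOpen_prod.mem_nhds ⟨hz₀, trivial⟩)).of_le (by simp)
  obtain ⟨z, hz0, ε, hε, hz⟩ :=
    hC.exists_forall_mem_closedBall_exists_eq_forall_mem_Ioo_hasDerivAt₀ 0
  have hz' : ∀ t ∈ Set.Ioo (-ε) ε, HasDerivAt z (hamVel G (z t), hamForce G (z t)) t := by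
    simpa using hz
  have hcont : ContinuousAt z 0 := (hz' 0 ⟨by linarith, hε⟩).continuousAt
  have hN' : z ⁻¹' N ∈ nhds (0 : ℝ) := hcont.preimage_mem_nhds (by rwa [hz0])
  obtain ⟨δ, hδ, hb⟩ := Metric.mem_nhds_iff.1 hN'
  refine ⟨min ε δ, lt_min hε hδ, z, hz0, fun t ht => ⟨hz' t ⟨?_, ?_⟩, hb ?_⟩⟩
  · have := min_le_left ε δ; linarith [ht.1]
  · have := min_le_left ε δ; linarith [ht.2]
  · have := min_le_right ε δ
    rw [Metric.mem_ball, Real.dist_eq, sub_zero, abs_lt]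
    exact ⟨by linarith [ht.1], by linarith [ht.2]⟩

/-- Conservation of energy: `fderiv_ham` applied to the Hamiltonian vector field gives two terms
that cancel. -/
theorem ham_eq_of_flow {z : ℝ → (Fin d → ℝ) × (Fin d → ℝ)} {T : ℝ}
    (hz : ∀ t ∈ Set.Icc 0 T,
      HasDerivWithinAt z (hamVel G (z t), hamForce G (z t)) (Set.Icc 0 T) t)
    (hU : ∀ t ∈ Set.Icc 0 T, (z t).1 ∈ U) : ∀ t ∈ Set.Icc 0 T, ham G (z t) = ham G (z 0) := by
  have hd : ∀ t ∈ Set.Icc 0 T, HasDerivWithinAt (fun t => ham G (z t)) 0 (Set.Icc 0 T) t := by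
    intro t ht
    have := ((hG.contDiffAt_ham (hU t ht)).differentiableAt
      (by simp)).hasFDerivAt.comp_hasDerivWithinAt t (hz t ht)
    rw [hG.fderiv_ham (hU t ht), dotProduct_comm, sub_self] at this
    exact this
  refine constant_of_has_deriv_right_zero (fun t ht => (hd t ht).continuousWithinAt)
    fun t ht => ?_
  exact (hd t ⟨ht.1, ht.2.le⟩).mono_of_mem_nhdsWithin (Icc_mem_nhdsGE_of_mem ht)

theorem two_mul_ham_eq {z : (Fin d → ℝ) × (Fin d → ℝ)} (hz : z.1 ∈ U) :
    2 * ham G z = hamVel G z ⬝ᵥ (G z.1 *ᵥ hamVel G z) := by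
  simp only [ham, hamVel]
  rw [hG.mulVec_inv hz, dotProduct_comm]
  ring

theorem continuousOn_energy {c : ℝ → (Fin d → ℝ)} (hc : ContDiffOn ℝ 1 c (Set.Icc 0 1))
    (hcU : Set.MapsTo c (Set.Icc 0 1) U) :
    ContinuousOn (fun t => derivWithin c (Set.Icc 0 1) t ⬝ᵥ
      (G (c t) *ᵥ derivWithin c (Set.Icc 0 1) t)) (Set.Icc 0 1) := by
  have hd : ContDiffOn ℝ 0 (derivWithin c (Set.Icc 0 1)) (Set.Icc 0 1) :=
    contDiffOn_zero.2 (hc.continuousOn_derivWithin (uniqueDiffOn_Icc one_pos) le_rfl)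
  refine (contDiffOn_dotProduct hd (contDiffOn_mulVec (fun i j => ?_) hd)).continuousOn
  exact ((hG.smooth i j).of_le (by simp)).comp (hc.of_le (by simp)) hcU

/-- Write `z = (X, S)` and `E` for the energy. The function `u(τ, x) = E τ + S(τ)⬝(x - X(τ)) - K τ
|x - X(τ)|²`, with the Euclidean square, is a subsolution of the Hamilton–Jacobi equation near the
geodesic: the first-order terms cancel by the flow equations, and the quadratic correction absorbs
the Taylor remainder. By Young's inequality the derivative of `2 ε u(ε t, c t)` is then at most the
energy density of `c`. Since `c` shares its end points with `X`, this function grows from `0` to `2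
ε² E`. -/
theorem calibration {z : ℝ → (Fin d → ℝ) × (Fin d → ℝ)} {z₀ : (Fin d → ℝ) × (Fin d → ℝ)}
    {ρ K ε : ℝ} (hK : 0 ≤ K) (hρU : Metric.ball z₀ ρ ⊆ U ×ˢ Set.univ)
    (hT : ∀ z ∈ Metric.ball z₀ ρ, ∀ w, z + w ∈ Metric.ball z₀ ρ →
        ham G (z + w) ≤ ham G z + fderiv ℝ (ham G) z w + K * ‖w‖ ^ 2)
    (hε : 0 < ε) (hKε : 2 * K * ε ≤ 1)
    (hz : ∀ t ∈ Set.Icc 0 ε, HasDerivAt z (hamVel G (z t), hamForce G (z t)) t)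
    (hzb : ∀ t ∈ Set.Icc 0 ε, z t ∈ Metric.ball z₀ (ρ / 3))
    {c : ℝ → (Fin d → ℝ)} (hc : ContDiffOn ℝ 1 c (Set.Icc 0 1))
    (hcb : ∀ t ∈ Set.Icc (0 : ℝ) 1, c t ∈ Metric.ball z₀.1 (ρ / 3))
    (hc0 : c 0 = (z 0).1) (hc1 : c 1 = (z ε).1) :
    2 * ε ^ 2 * ham G (z 0) ≤ metricAction G c := by
  have hcz : ∀ t ∈ Set.Icc (0 : ℝ) 1, ε * t ∈ Set.Icc 0 ε := fun t ht =>
    ⟨by have := ht.1; positivity, by nlinarith [ht.2]⟩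
  have hρ3 : Metric.ball z₀ (ρ / 3) ⊆ Metric.ball z₀ ρ := by
    intro x hx
    have h1 := Metric.mem_ball.1 hx
    have h2 := dist_nonneg (x := x) (y := z₀)
    exact Metric.mem_ball.2 (by linarith)
  have hE : ∀ t ∈ Set.Icc 0 ε, ham G (z t) = ham G (z 0) :=
    hG.ham_eq_of_flow (fun t ht => (hz t ht).hasDerivWithinAt)
      fun t ht => (hρU (hρ3 (hzb t ht))).1
  have hcU : Set.MapsTo c (Set.Icc 0 1) U := by
    intro t ht
    have h1 : ((c t, z₀.2) : (Fin d → ℝ) × (Fin d → ℝ)) ∈ Metric.ball z₀ ρ := by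
      have h1 := Metric.mem_ball.1 (hcb t ht)
      have h2 := dist_nonneg (x := c t) (y := z₀.1)
      rw [Metric.mem_ball, Prod.dist_eq, dist_self, max_eq_left h2]
      linarith
    exact (hρU h1).1
  set E := ham G (z 0) with hEdef
  set φ : ℝ → ℝ := fun t => 2 * ε * (E * (ε * t) + (z (ε * t)).2 ⬝ᵥ (c t - (z (ε * t)).1)
    + 1 / 2 * ((-2 * K * (ε * t)) * ((c t - (z (ε * t)).1) ⬝ᵥ (c t - (z (ε * t)).1)))) with hφ
  set c' := derivWithin c (Set.Icc 0 1) with hc'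
  set φ' : ℝ → ℝ := fun t => 2 * ε * (E * ε + ((ε • hamForce G (z (ε * t))) ⬝ᵥ
    (c t - (z (ε * t)).1) + (z (ε * t)).2 ⬝ᵥ (c' t - ε • hamVel G (z (ε * t))))
    + 1 / 2 * ((-2 * K * ε) * ((c t - (z (ε * t)).1) ⬝ᵥ (c t - (z (ε * t)).1)) +
      (-2 * K * (ε * t)) * ((c' t - ε • hamVel G (z (ε * t))) ⬝ᵥ (c t - (z (ε * t)).1) +
        (c t - (z (ε * t)).1) ⬝ᵥ (c' t - ε • hamVel G (z (ε * t)))))) with hφ'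
  have hd : ∀ t ∈ Set.Icc (0 : ℝ) 1, HasDerivWithinAt φ (φ' t) (Set.Icc 0 1) t := by
    intro t ht
    have h1 : HasDerivWithinAt c (c' t) (Set.Icc 0 1) t :=
      ((hc.differentiableOn one_ne_zero) t ht).hasDerivWithinAt
    have hlin : HasDerivAt (fun t : ℝ => ε * t) ε t := by
      simpa using (hasDerivAt_id t).const_mul ε
    have h2 : HasDerivAt (fun t => z (ε * t)) (ε • (hamVel G (z (ε * t)), hamForce G (z (ε * t))))
        t := (hz _ (hcz t ht)).scomp t hlin
    have h3 : HasDerivAt (fun t => (z (ε * t)).1) (ε • hamVel G (z (ε * t))) t := h2.fst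
    have h4 : HasDerivAt (fun t => (z (ε * t)).2) (ε • hamForce G (z (ε * t))) t := h2.snd
    have hy := h1.sub h3.hasDerivWithinAt
    have hlin' := hlin.hasDerivWithinAt (s := Set.Icc (0 : ℝ) 1)
    exact (((hlin'.const_mul E).add (hasDerivWithinAt_dotProduct h4.hasDerivWithinAt hy)).add
      (((hlin'.const_mul (-2 * K)).mul (hasDerivWithinAt_dotProduct hy hy)).const_mul
        (1 / 2))).const_mul (2 * ε)
  have hle : ∀ t ∈ Set.Icc (0 : ℝ) 1, φ' t ≤ c' t ⬝ᵥ (G (c t) *ᵥ c' t) := by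
    intro t ht
    set Z := z (ε * t) with hZ
    have hZb := hzb _ (hcz t ht)
    rw [← hZ] at hZb
    have hZU : Z.1 ∈ U := (hρU (hρ3 hZb)).1
    set y := c t - Z.1 with hy
    -- The `x`-gradient of `u` at `c t` is `Z.2 + k • y`. The bound `2 K ε ≤ 1` makes `|k| ≤ 1`, so
    -- the displacement `(y, k • y)` has sup norm at most `‖y‖` and its remainder is at most `K (y
    -- ⬝ᵥ y)`.
    set k := -2 * K * (ε * t) with hk
    have hk1 : |k| ≤ 1 := by
      rw [abs_le]
      have := (hcz t ht).1
      have := (hcz t ht).2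
      constructor <;> nlinarith
    have hw : ‖((y, k • y) : (Fin d → ℝ) × (Fin d → ℝ))‖ ≤ ‖y‖ := by
      rw [Prod.norm_def, norm_smul, Real.norm_eq_abs]
      exact max_le le_rfl (mul_le_of_le_one_left (norm_nonneg _) hk1)
    have hZ1 : dist Z.1 z₀.1 < ρ / 3 :=
      lt_of_le_of_lt (by rw [Prod.dist_eq]; exact le_max_left _ _) (Metric.mem_ball.1 hZb)
    have hyρ : ‖y‖ < 2 * ρ / 3 := by
      have h1 := Metric.mem_ball.1 (hcb t ht)
      have h2 := dist_triangle_right (c t) Z.1 z₀.1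
      rw [hy, ← dist_eq_norm]
      linarith
    have hmem : Z + (y, k • y) ∈ Metric.ball z₀ ρ := by
      have h1 := Metric.mem_ball.1 hZb
      have h2 : dist (Z + (y, k • y)) Z ≤ ‖y‖ := by
        rw [dist_eq_norm, add_sub_cancel_left]; exact hw
      have h3 := dist_triangle (Z + (y, k • y)) Z z₀
      exact Metric.mem_ball.2 (by linarith)
    have hTZ := hT Z (hρ3 hZb) _ hmem
    rw [hG.fderiv_ham hZU, hE _ (hcz t ht)] at hTZ
    have hZw : Z + (y, k • y) = (c t, Z.2 + k • y) := by
      ext1 <;> simp [hy]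
    rw [hZw] at hTZ
    have hnn : K * ‖((y, k • y) : (Fin d → ℝ) × (Fin d → ℝ))‖ ^ 2 ≤ K * (y ⬝ᵥ y) := by
      gcongr
      refine le_trans ?_ (sq_norm_le_dotProduct y)
      gcongr
    have hY := hG.young (hcU ht) (Z.2 + k • y) (c' t) hε
    have hSV : Z.2 ⬝ᵥ hamVel G Z = 2 * E := by
      rw [← hE _ (hcz t ht), ← hZ]
      simp only [ham, hamVel]
      ring
    have hYε : 2 * ε * ((Z.2 + k • y) ⬝ᵥ c' t) ≤
        2 * ε * (ε * ham G (c t, Z.2 + k • y)) + c' t ⬝ᵥ (G (c t) *ᵥ c' t) := by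
      have h := mul_le_mul_of_nonneg_left hY (by positivity : 0 ≤ 2 * ε)
      have he : 2 * ε * (1 / (2 * ε) * (c' t ⬝ᵥ (G (c t) *ᵥ c' t))) =
        c' t ⬝ᵥ (G (c t) *ᵥ c' t) := by field_simp
      rw [mul_add, he] at h
      exact h
    have hTε : 2 * ε * (ε * ham G (c t, Z.2 + k • y)) ≤ 2 * ε * (ε *
        (E + (hamVel G Z ⬝ᵥ k • y - hamForce G Z ⬝ᵥ y) + K * (y ⬝ᵥ y))) := by
      gcongr
      linarith
    have hφt : φ' t = 2 * ε * ((Z.2 + k • y) ⬝ᵥ c' t) - 2 * ε * (ε *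
        (E + (hamVel G Z ⬝ᵥ k • y - hamForce G Z ⬝ᵥ y) + K * (y ⬝ᵥ y))) := by
      simp only [hφ', ← hZ, ← hk, ← hy]
      simp only [add_dotProduct, smul_dotProduct, dotProduct_smul, dotProduct_sub,
        sub_dotProduct, smul_eq_mul]
      rw [hSV, dotProduct_comm (c' t) y, dotProduct_comm (hamVel G Z) y]
      ring
    linarith
  have hint := intervalIntegral.sub_le_integral_of_hasDeriv_right_of_le (g := φ) (g' := φ')
    zero_le_one (fun t ht => (hd t ht).continuousWithinAt)
    (fun t ht => ((hd t (Set.Ioo_subset_Icc_self ht)).hasDerivAt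
      (Icc_mem_nhds ht.1 ht.2)).hasDerivWithinAt)
    ((hG.continuousOn_energy hc hcU).integrableOn_Icc) fun t ht =>
      hle t (Set.Ioo_subset_Icc_self ht)
  refine le_trans (le_of_eq ?_) hint
  simp only [hφ, mul_zero, mul_one, hc0, hc1, sub_self, dotProduct_zero]
  ring

theorem exists_coercive {x₀ : Fin d → ℝ} {r : ℝ}
    (hrU : Metric.closedBall x₀ r ⊆ U) :
    ∃ m > 0, ∀ x ∈ Metric.closedBall x₀ r, ∀ a, m * ‖a‖ ^ 2 ≤ a ⬝ᵥ (G x *ᵥ a) := by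
  set Q : (Fin d → ℝ) × (Fin d → ℝ) → ℝ := fun z => z.2 ⬝ᵥ (G z.1 *ᵥ z.2) with hQ
  have hcont : ContinuousOn Q (Metric.closedBall x₀ r ×ˢ Metric.sphere 0 1) :=
    (contDiffOn_dotProduct contDiffOn_snd (contDiffOn_mulVec
      (fun i j => ((hG.smooth i j).of_le (by simp)).comp (contDiffOn_fst)
        fun z hz => hrU hz.1) contDiffOn_snd) :
      ContDiffOn ℝ 0 Q (Metric.closedBall x₀ r ×ˢ Metric.sphere 0 1)).continuousOn
  have hpos : ∀ z ∈ Metric.closedBall x₀ r ×ˢ Metric.sphere (0 : Fin d → ℝ) 1, 0 < Q z := by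
    intro z hz
    refine hG.pos _ (hrU hz.1) _ fun h => ?_
    have := hz.2
    simp [h] at this
  obtain ⟨m, hm, hmQ⟩ : ∃ m > 0, ∀ z ∈ Metric.closedBall x₀ r ×ˢ Metric.sphere (0 : Fin d → ℝ) 1,
      m ≤ Q z := by
    rcases (Metric.closedBall x₀ r ×ˢ Metric.sphere (0 : Fin d → ℝ) 1).eq_empty_or_nonempty with
      h | h
    -- The product is empty when `d = 0` or `r < 0`; any positive constant serves.
    · exact ⟨1, one_pos, by simp [h]⟩
    · obtain ⟨z, hz, hmin⟩ := ((isCompact_closedBall x₀ r).prod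
        (isCompact_sphere (0 : Fin d → ℝ) 1)).exists_isMinOn h hcont
      exact ⟨Q z, hpos z hz, fun w hw => hmin hw⟩
  refine ⟨m, hm, fun x hx a => ?_⟩
  rcases eq_or_ne a 0 with rfl | ha
  · simp
  have hn : 0 < ‖a‖ := norm_pos_iff.2 ha
  have h := hmQ (x, ‖a‖⁻¹ • a) ⟨hx, by simp [norm_smul, hn.ne']⟩
  simp only [hQ, Matrix.mulVec_smul, smul_dotProduct, dotProduct_smul, smul_eq_mul] at h
  calc m * ‖a‖ ^ 2 ≤ (‖a‖⁻¹ * (‖a‖⁻¹ * a ⬝ᵥ G x *ᵥ a)) * ‖a‖ ^ 2 := by gcongr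
    _ = a ⬝ᵥ (G x *ᵥ a) := by field_simp

end IsSmoothMetricOn
namespace IsSmoothMetricOn

variable {d : ℕ} {G : (Fin d → ℝ) → Matrix (Fin d) (Fin d) ℝ} {U : Set (Fin d → ℝ)}
  (hG : IsSmoothMetricOn G U)

include hG

/-- Up to the first exit time some coordinate moves by at least `r`. Bounding its speed by `‖c'‖ ≤ m
‖c'‖² / (2 m r) + r / 2` and integrating over a time at most `1` gives the estimate without
Cauchy–Schwarz for integrals. -/
theorem le_action_of_exits {x₀ : Fin d → ℝ} {r m : ℝ} (hr : 0 < r) (hm : 0 < m)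
    (hcoer : ∀ x ∈ Metric.closedBall x₀ r, ∀ a, m * ‖a‖ ^ 2 ≤ a ⬝ᵥ (G x *ᵥ a))
    {c : ℝ → (Fin d → ℝ)} (hc : ContDiffOn ℝ 1 c (Set.Icc 0 1))
    (hcU : Set.MapsTo c (Set.Icc 0 1) U) (hc0 : c 0 = x₀)
    (hex : ∃ t ∈ Set.Icc (0 : ℝ) 1, r ≤ ‖c t - x₀‖) :
    m * r ^ 2 ≤ metricAction G c := by
  set c' := derivWithin c (Set.Icc 0 1) with hc'
  set e : ℝ → ℝ := fun t => c' t ⬝ᵥ (G (c t) *ᵥ c' t) with he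
  have hcont : ContinuousOn (fun t => ‖c t - x₀‖) (Set.Icc 0 1) :=
    (hc.continuousOn.sub continuousOn_const).norm
  set A := Set.Icc (0 : ℝ) 1 ∩ (fun t => ‖c t - x₀‖) ⁻¹' Set.Ici r with hA
  have hAc : IsCompact A := isCompact_Icc.of_isClosed_subset
    (hcont.preimage_isClosed_of_isClosed isClosed_Icc isClosed_Ici) Set.inter_subset_left
  obtain ⟨T, hTA, hTmin⟩ := hAc.exists_isLeast (by obtain ⟨t, ht, h⟩ := hex; exact ⟨t, ht, h⟩)
  have hT01 : T ∈ Set.Icc (0 : ℝ) 1 := hTA.1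
  have hTr : r ≤ ‖c T - x₀‖ := hTA.2
  have hin : ∀ t ∈ Set.Ioo 0 T, c t ∈ Metric.closedBall x₀ r := by
    intro t ht
    rw [Metric.mem_closedBall, dist_eq_norm]
    by_contra h
    exact absurd (hTmin ⟨⟨ht.1.le, ht.2.le.trans hT01.2⟩, (not_le.1 h).le⟩) (not_le.2 ht.2)
  obtain ⟨k, hk⟩ : ∃ k, r ≤ |c T k - x₀ k| := by
    by_contra h
    push Not at h
    exact absurd hTr (not_le.2 ((pi_norm_lt_iff hr).2 fun k => by simpa using h k))
  have hdk : ∀ t ∈ Set.Icc (0 : ℝ) 1,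
      HasDerivWithinAt (fun t => c t k) (c' t k) (Set.Icc 0 1) t := fun t ht =>
    hasDerivWithinAt_pi.1 ((hc.differentiableOn one_ne_zero) t ht).hasDerivWithinAt k
  obtain ⟨σ, hσ, hσr⟩ : ∃ σ : ℝ, |σ| = 1 ∧ r ≤ σ * (c T k - x₀ k) := by
    rcases abs_cases (c T k - x₀ k) with h | h
    · exact ⟨1, by simp, by linarith⟩
    · exact ⟨-1, by simp, by linarith⟩
  have hsub : Set.Icc 0 T ⊆ Set.Icc (0 : ℝ) 1 := Set.Icc_subset_Icc_right hT01.2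
  have hecont := hG.continuousOn_energy hc hcU
  have hint := intervalIntegral.sub_le_integral_of_hasDeriv_right_of_le
    (g := fun t => σ * c t k) (g' := fun t => σ * c' t k)
    (φ := fun t => 1 / (2 * m * r) * e t + r / 2) hT01.1
    (fun t ht => (((hdk t (hsub ht)).const_mul σ).continuousWithinAt).mono hsub)
    (fun t ht => (((hdk t (hsub (Set.Ioo_subset_Icc_self ht))).hasDerivAt
      (Icc_mem_nhds ht.1 (ht.2.trans_le hT01.2))).const_mul σ).hasDerivWithinAt)
    (((hecont.mono hsub).const_smul (1 / (2 * m * r))).add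
      continuousOn_const).integrableOn_Icc
    (fun t ht => by
      have h1 := hcoer _ (hin t ht) (c' t)
      have h2 : σ * c' t k ≤ ‖c' t‖ := by
        refine (le_abs_self _).trans ?_
        rw [abs_mul, hσ, one_mul]
        exact norm_le_pi_norm (c' t) k
      have h3 : ‖c' t‖ ≤ 1 / (2 * m * r) * (m * ‖c' t‖ ^ 2) + r / 2 := by
        have : 1 / (2 * m * r) * (m * ‖c' t‖ ^ 2) + r / 2 - ‖c' t‖
          = (‖c' t‖ - r) ^ 2 / (2 * r) := by field_simp; ring
        have h4 : 0 ≤ (‖c' t‖ - r) ^ 2 / (2 * r) := by positivity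
        linarith
      have h5 : 1 / (2 * m * r) * (m * ‖c' t‖ ^ 2) ≤ 1 / (2 * m * r) * e t := by gcongr
      linarith)
  have heint : ∀ a b, a ∈ Set.Icc (0 : ℝ) 1 → b ∈ Set.Icc (0 : ℝ) 1 → a ≤ b →
      IntervalIntegrable e MeasureTheory.volume a b := fun a b ha hb hab => by
    refine ContinuousOn.intervalIntegrable (hecont.mono ?_)
    rw [Set.uIcc_of_le hab]
    exact Set.Icc_subset_Icc ha.1 hb.2
  have h0 : (0 : ℝ) ∈ Set.Icc (0 : ℝ) 1 := by simp
  have h1 : (1 : ℝ) ∈ Set.Icc (0 : ℝ) 1 := by simp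
  have heT := heint 0 T h0 hT01 hT01.1
  rw [intervalIntegral.integral_add (heT.const_mul _) (by simp),
    intervalIntegral.integral_const_mul, intervalIntegral.integral_const] at hint
  have hrest : 0 ≤ ∫ t in T..1, e t := intervalIntegral.integral_nonneg hT01.2 fun t ht =>
    hG.nonneg (hcU ⟨hT01.1.trans ht.1, ht.2⟩) _
  have hsplit := intervalIntegral.integral_add_adjacent_intervals heT (heint T 1 hT01 h1 hT01.2)
  have hact : metricAction G c = ∫ t in (0 : ℝ)..1, e t := rfl
  have hle : r ≤ 1 / (2 * m * r) * (∫ t in (0 : ℝ)..T, e t) + r / 2 := by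
    have hb : (T - 0) • (r / 2) ≤ r / 2 := by
      rw [smul_eq_mul, sub_zero]
      exact mul_le_of_le_one_left (by positivity) hT01.2
    have hc0k : c 0 k = x₀ k := by rw [hc0]
    have hs : σ * c T k - σ * c 0 k = σ * (c T k - x₀ k) := by rw [hc0k]; ring
    have h := hint
    simp only [hs] at h
    linarith
  have h6 : m * r ^ 2 ≤ ∫ t in (0 : ℝ)..T, e t := by
    have h7 : r / 2 * (2 * m * r) ≤ ∫ t in (0 : ℝ)..T, e t := by
      rw [← le_div_iff₀ (by positivity)]
      rw [one_div, inv_mul_eq_div] at hle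
      linarith
    linarith [h7, (by ring : r / 2 * (2 * m * r) = m * r ^ 2)]
  rw [hact, ← hsplit]
  linarith

/-- Short solutions of the geodesic equations minimize the action. -/
theorem exists_minimizing_flow {Θ : Set (Fin d → ℝ)} (hΘU : Θ ⊆ U) {x₀ : Fin d → ℝ}
    (hx₀ : x₀ ∈ interior Θ) (a : Fin d → ℝ) :
    ∃ δ > 0, ∃ z : ℝ → (Fin d → ℝ) × (Fin d → ℝ), z 0 = (x₀, G x₀ *ᵥ a) ∧
      (∀ t ∈ Set.Ioo (-δ) δ, HasDerivAt z (hamVel G (z t), hamForce G (z t)) t ∧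
        (z t).1 ∈ interior Θ) ∧
      ∀ ε ∈ Set.Ioo 0 δ, ∀ c : ℝ → (Fin d → ℝ), ContDiffOn ℝ 1 c (Set.Icc 0 1) →
        Set.MapsTo c (Set.Icc 0 1) Θ → c 0 = x₀ → c 1 = (z ε).1 →
        ε ^ 2 * (a ⬝ᵥ (G x₀ *ᵥ a)) ≤ metricAction G c := by
  have hx₀U : x₀ ∈ U := hΘU (interior_subset hx₀)
  set z₀ : (Fin d → ℝ) × (Fin d → ℝ) := (x₀, G x₀ *ᵥ a) with hz₀
  obtain ⟨ρ, hρ, K, hK, hρU, hT⟩ := hG.exists_ham_taylor (z₀ := z₀) hx₀U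
  set r := ρ / 6 with hr
  have hrpos : 0 < r := by positivity
  have hrU : Metric.closedBall x₀ r ⊆ U := by
    intro x hx
    have h1 := Metric.mem_closedBall.1 hx
    have h2 : ((x, z₀.2) : (Fin d → ℝ) × (Fin d → ℝ)) ∈ Metric.ball z₀ ρ := by
      rw [Metric.mem_ball, Prod.dist_eq, dist_self, max_eq_left dist_nonneg]
      change dist x x₀ < ρ
      linarith
    exact (hρU h2).1
  obtain ⟨m, hm, hcoer⟩ := hG.exists_coercive hrU
  have hN : Metric.ball z₀ (ρ / 3) ∩ (interior Θ ×ˢ Set.univ) ∈ nhds z₀ :=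
    Filter.inter_mem (Metric.ball_mem_nhds _ (by positivity))
      ((isOpen_interior.prod isOpen_univ).mem_nhds ⟨hx₀, trivial⟩)
  obtain ⟨δ, hδ, z, hz0, hz⟩ := hG.exists_flow (z₀ := z₀) hx₀U hN
  set q := a ⬝ᵥ (G x₀ *ᵥ a) with hq
  have hq0 : 0 ≤ q := hG.nonneg hx₀U a
  have hham : ham G (z 0) = q / 2 := by
    rw [hz0, hz₀, ham]
    simp only
    rw [hG.inv_mulVec hx₀U, dotProduct_comm]
    ring
  -- The second entry gives `2 K ε ≤ 1` for `calibration`. The last two give `ε² ≤ ε` and `ε (q + 1)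
  -- ≤ m r²`, so that `ε² q` does not exceed the cost of leaving the ball of radius `r`.
  set δ' := min δ (min (1 / (2 * K + 1)) (min 1 (m * r ^ 2 / (q + 1)))) with hδ'
  have hδ'1 : δ' ≤ δ := min_le_left _ _
  have hδ'2 : δ' ≤ 1 / (2 * K + 1) := (min_le_right _ _).trans (min_le_left _ _)
  have hδ'3 : δ' ≤ 1 := (min_le_right _ _).trans ((min_le_right _ _).trans (min_le_left _ _))
  have hδ'4 : δ' ≤ m * r ^ 2 / (q + 1) :=
    (min_le_right _ _).trans ((min_le_right _ _).trans (min_le_right _ _))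
  refine ⟨δ', by positivity, z, hz0, fun t ht => ?_, fun ε hε c hc hcΘ hc0 hc1 => ?_⟩
  · have := hz t ⟨by linarith [ht.1], by linarith [ht.2]⟩
    exact ⟨this.1, this.2.2.1⟩
  have hε1 : ε < δ := hε.2.trans_le hδ'1
  have hcU : Set.MapsTo c (Set.Icc 0 1) U := fun t ht => hΘU (hcΘ ht)
  by_cases hex : ∃ t ∈ Set.Icc (0 : ℝ) 1, r ≤ ‖c t - x₀‖
  · refine le_trans ?_ (hG.le_action_of_exits hrpos hm hcoer hc hcU hc0 hex)
    have h1 : ε * (q + 1) ≤ m * r ^ 2 := by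
      rw [← le_div_iff₀ (by positivity)]
      linarith [hε.2]
    have h2 : ε ^ 2 ≤ ε := by nlinarith [hε.1, hε.2]
    nlinarith
  · push Not at hex
    have h := hG.calibration (z := z) (c := c) hK hρU hT hε.1 ?_
      (fun t ht => (hz t ⟨by linarith [ht.1], ht.2.trans_lt hε1⟩).1)
      (fun t ht => (hz t ⟨by linarith [ht.1], ht.2.trans_lt hε1⟩).2.1) hc
      (fun t ht => ?_) (by rw [hc0, hz0]) hc1
    · rw [hham] at h
      linarith
    · have h1 : ε * (2 * K + 1) ≤ 1 := by
        rw [← le_div_iff₀ (by positivity)]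
        linarith [hε.2]
      linarith [hε.1]
    · rw [Metric.mem_ball, dist_eq_norm]
      have := hex t ht
      change ‖c t - x₀‖ < ρ / 3
      linarith

end IsSmoothMetricOn
-- The weighted Laplacian and its pseudo-inverse.
namespace WeightedGraph

variable {n : ℕ} (W : WeightedGraph n)

/-- The open positive orthant. -/
def _root_.DiscreteOT.posOrthant (n : ℕ) : Set (Fin n → ℝ) := {q | ∀ i, 0 < q i}

theorem _root_.DiscreteOT.isOpen_posOrthant (n : ℕ) : IsOpen (posOrthant n) := by
  have : posOrthant n = Set.univ.pi fun _ => Set.Ioi (0 : ℝ) := by ext; simp [posOrthant]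
  rw [this]
  exact isOpen_set_pi Set.finite_univ fun _ _ => isOpen_Ioi

theorem dotProduct_laplacian (q Φ Ψ : Fin n → ℝ) :
    Φ ⬝ᵥ (W.laplacian q *ᵥ Ψ) = ∑ i, q i * W.Gam Φ Ψ i := by
  -- The difference of the two sides as a double sum; by symmetry of the weights `F` is
  -- antisymmetric in `i` and `j`.
  set F : Fin n → Fin n → ℝ := fun i j => Φ i * (W.weight i j * (Ψ i - Ψ j) * ((q i + q j) / 2))
    - q i * ((1 / 2) * (W.weight i j * (Φ i - Φ j) * (Ψ i - Ψ j))) with hF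
  have h1 : ∑ i, ∑ j, F i j = -∑ i, ∑ j, F i j := by
    conv_lhs => rw [Finset.sum_comm]
    simp only [← Finset.sum_neg_distrib]
    refine Finset.sum_congr rfl fun i _ => Finset.sum_congr rfl fun j _ => ?_
    simp only [hF, W.weight_symm j i]
    ring
  have h2 : ∑ i, ∑ j, F i j = 0 := by linarith
  rw [laplacian_mulVec, ← sub_eq_zero, ← h2]
  simp only [dotProduct, velocity, Gam, hF, Finset.sum_sub_distrib, Finset.mul_sum]

theorem Gam_comm (Φ Ψ : Fin n → ℝ) : W.Gam Φ Ψ = W.Gam Ψ Φ := by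
  funext i
  simp only [Gam]
  congr 1
  exact Finset.sum_congr rfl fun j _ => by ring

theorem dotProduct_laplacian_comm (q Φ Ψ : Fin n → ℝ) :
    Φ ⬝ᵥ (W.laplacian q *ᵥ Ψ) = Ψ ⬝ᵥ (W.laplacian q *ᵥ Φ) := by
  rw [dotProduct_laplacian, dotProduct_laplacian, Gam_comm]

theorem laplacian_mulVec_sub_const (q Φ : Fin n → ℝ) (c : ℝ) :
    W.laplacian q *ᵥ (fun i => Φ i - c) = W.laplacian q *ᵥ Φ := by
  rw [laplacian_mulVec, laplacian_mulVec]
  funext i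
  simp [velocity]

theorem laplacian_mulVec_const (q : Fin n → ℝ) (c : ℝ) :
    W.laplacian q *ᵥ (fun _ => c) = 0 := by
  rw [laplacian_mulVec]
  funext i
  simp [velocity]

theorem sum_laplacian_mulVec (q Φ : Fin n → ℝ) : ∑ i, (W.laplacian q *ᵥ Φ) i = 0 := by
  have h := W.dotProduct_laplacian_comm q (fun _ => 1) Φ
  rw [laplacian_mulVec_const, dotProduct_zero] at h
  simpa [dotProduct] using h

theorem laplacian_add_smul (q w : Fin n → ℝ) (t : ℝ) (i j : Fin n) :
    W.laplacian (q + t • w) i j = W.laplacian q i j + t * W.laplacian w i j := by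
  simp only [laplacian, Matrix.sub_apply, Matrix.diagonal_apply, Matrix.of_apply, Pi.add_apply,
    Pi.smul_apply, smul_eq_mul]
  split_ifs with h
  · rw [mul_sub, Finset.mul_sum, ← add_sub_add_comm, ← Finset.sum_add_distrib]
    congr 1
    · exact Finset.sum_congr rfl fun j _ => by ring
    · ring
  · ring

theorem weight_nonneg (i j : Fin n) : 0 ≤ W.weight i j := by
  by_cases h : W.graph.Adj i j
  · exact (W.weight_pos i j h).le
  · exact (W.weight_eq_zero i j h).ge

theorem Gam_self_nonneg (Φ : Fin n → ℝ) (i : Fin n) : 0 ≤ W.Gam Φ Φ i := by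
  refine mul_nonneg (by norm_num) (Finset.sum_nonneg fun j _ => ?_)
  rw [mul_assoc]
  exact mul_nonneg (W.weight_nonneg i j) (mul_self_nonneg _)

theorem dotProduct_laplacian_nonneg {q : Fin n → ℝ} (hq : q ∈ posOrthant n) (Φ : Fin n → ℝ) :
    0 ≤ Φ ⬝ᵥ (W.laplacian q *ᵥ Φ) := by
  rw [dotProduct_laplacian]
  exact Finset.sum_nonneg fun i _ => mul_nonneg (hq i).le (W.Gam_self_nonneg Φ i)

variable {W} (hW : W.graph.Connected) {q : Fin n → ℝ} (hq : q ∈ posOrthant n)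

include hW hq in
theorem eq_of_dotProduct_laplacian_eq_zero {Φ : Fin n → ℝ}
    (h : Φ ⬝ᵥ (W.laplacian q *ᵥ Φ) = 0) (i j : Fin n) : Φ i = Φ j := by
  rw [dotProduct_laplacian, Finset.sum_eq_zero_iff_of_nonneg fun i _ =>
    mul_nonneg (hq i).le (W.Gam_self_nonneg Φ i)] at h
  have hadj : ∀ i j, W.graph.Adj i j → Φ i = Φ j := by
    intro i j hij
    have h1 : W.Gam Φ Φ i = 0 := by
      have := h i (Finset.mem_univ i)
      exact (mul_eq_zero.1 this).resolve_left (hq i).ne'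
    have h2 : ∑ j, W.weight i j * (Φ i - Φ j) * (Φ i - Φ j) = 0 := by
      simpa [Gam] using h1
    rw [Finset.sum_eq_zero_iff_of_nonneg] at h2
    · have h3 := h2 j (Finset.mem_univ j)
      rw [mul_assoc] at h3
      have := mul_self_eq_zero.1 ((mul_eq_zero.1 h3).resolve_left (W.weight_pos i j hij).ne')
      linarith
    · intro k _
      rw [mul_assoc]
      exact mul_nonneg (W.weight_nonneg i k) (mul_self_nonneg _)
  obtain ⟨w⟩ := hW.preconnected i j
  induction w with
  | nil => rfl
  | cons h _ ih => exact (hadj _ _ h).trans ih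

variable (W) in
theorem laplacianPinv_eq_cfc (q : Fin n → ℝ) :
    W.laplacianPinv q = cfc (fun μ : ℝ => μ⁻¹) (W.laplacian q) :=
  ((W.laplacian_isHermitian q).cfc_eq _).symm

/-- A matrix has finite, hence discrete, spectrum. The functional calculus thus accepts `μ⁻¹`
despite its jump at `0`. -/
theorem _root_.DiscreteOT.continuousOn_spectrum {A : Matrix (Fin n) (Fin n) ℝ} (g : ℝ → ℝ) :
    ContinuousOn g (spectrum ℝ A) := by
  rw [continuousOn_iff_continuous_domRestrict]; fun_prop

variable (W) in
theorem laplacian_mul_pinv_mul (q : Fin n → ℝ) :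
    W.laplacian q * W.laplacianPinv q * W.laplacian q = W.laplacian q := by
  have hL : IsSelfAdjoint (W.laplacian q) := W.laplacian_isHermitian q
  rw [laplacianPinv_eq_cfc]
  conv_lhs =>
    enter [1, 1]
    rw [← cfc_id' ℝ (W.laplacian q)]
  conv_lhs =>
    enter [2]
    rw [← cfc_id' ℝ (W.laplacian q)]
  rw [← cfc_mul _ _ _ (continuousOn_spectrum _) (continuousOn_spectrum _),
    ← cfc_mul _ _ _ (continuousOn_spectrum _) (continuousOn_spectrum _)]
  simp only [mul_inv_mul_cancel]
  exact cfc_id' ℝ (W.laplacian q)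

variable (W) in
theorem pinv_mul_laplacian_mul (q : Fin n → ℝ) :
    W.laplacianPinv q * W.laplacian q * W.laplacianPinv q = W.laplacianPinv q := by
  have hL : IsSelfAdjoint (W.laplacian q) := W.laplacian_isHermitian q
  rw [laplacianPinv_eq_cfc]
  conv_lhs =>
    enter [1, 2]
    rw [← cfc_id' ℝ (W.laplacian q)]
  rw [← cfc_mul _ _ _ (continuousOn_spectrum _) (continuousOn_spectrum _),
    ← cfc_mul _ _ _ (continuousOn_spectrum _) (continuousOn_spectrum _)]
  congr 1
  funext x
  rcases eq_or_ne x 0 with rfl | hx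
  · simp
  · field_simp

variable (W) in
theorem laplacian_mul_pinv_comm (q : Fin n → ℝ) :
    W.laplacian q * W.laplacianPinv q = W.laplacianPinv q * W.laplacian q := by
  have hL : IsSelfAdjoint (W.laplacian q) := W.laplacian_isHermitian q
  rw [laplacianPinv_eq_cfc]
  exact (cfc_commute_cfc (fun x : ℝ => x) (fun x => x⁻¹) (W.laplacian q) |>.eq |> fun h => by
    rwa [cfc_id' ℝ (W.laplacian q)] at h)

variable (W) in
theorem laplacianPinv_transpose (q : Fin n → ℝ) : (W.laplacianPinv q)ᵀ = W.laplacianPinv q := by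
  have h : IsSelfAdjoint (W.laplacianPinv q) := by
    rw [laplacianPinv_eq_cfc]; exact cfc_predicate _ _
  have h2 : (W.laplacianPinv q)ᴴ = W.laplacianPinv q := h
  simpa [Matrix.conjTranspose_eq_transpose_of_trivial] using h2

variable (W) in
theorem dotProduct_pinv_comm (q σ τ : Fin n → ℝ) :
    σ ⬝ᵥ (W.laplacianPinv q *ᵥ τ) = τ ⬝ᵥ (W.laplacianPinv q *ᵥ σ) := by
  rw [Matrix.dotProduct_mulVec, ← Matrix.mulVec_transpose, laplacianPinv_transpose,
    dotProduct_comm]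

variable (W) in
theorem pinv_mulVec_const (q : Fin n → ℝ) (c : ℝ) : W.laplacianPinv q *ᵥ (fun _ => c) = 0 := by
  rw [← pinv_mul_laplacian_mul, mul_assoc, laplacian_mul_pinv_comm, ← mul_assoc,
    ← Matrix.mulVec_mulVec, laplacian_mulVec_const, Matrix.mulVec_zero]

include hW hq

theorem laplacian_pinv_mulVec {σ : Fin n → ℝ} (hσ : ∑ i, σ i = 0) :
    W.laplacian q *ᵥ (W.laplacianPinv q *ᵥ σ) = σ := by
  set ν := W.laplacian q *ᵥ (W.laplacianPinv q *ᵥ σ) - σ with hν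
  have h1 : W.laplacian q *ᵥ ν = 0 := by
    rw [hν, Matrix.mulVec_sub, Matrix.mulVec_mulVec σ, laplacian_mul_pinv_comm,
      Matrix.mulVec_mulVec, ← mul_assoc, laplacian_mul_pinv_mul, sub_self]
  have h2 := eq_of_dotProduct_laplacian_eq_zero hW hq (Φ := ν) (by rw [h1, dotProduct_zero])
  have h3 : ∑ i, ν i = 0 := by
    simp only [hν, Pi.sub_apply, Finset.sum_sub_distrib, sum_laplacian_mulVec, hσ, sub_zero]
  have h4 : ν = 0 := by
    funext i
    rw [Finset.sum_congr rfl fun j _ => h2 j i] at h3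
    have hn : (n : ℝ) ≠ 0 := by
      have : 0 < n := Fin.pos i
      positivity
    simpa [hn] using h3
  exact sub_eq_zero.1 h4

theorem pinv_laplacian_mulVec {σ : Fin n → ℝ} (hσ : ∑ i, σ i = 0) :
    W.laplacianPinv q *ᵥ (W.laplacian q *ᵥ σ) = σ := by
  rw [Matrix.mulVec_mulVec, ← laplacian_mul_pinv_comm, ← Matrix.mulVec_mulVec,
    laplacian_pinv_mulVec hW hq hσ]

theorem exists_pinv_laplacian_mulVec (Φ : Fin n → ℝ) :
    ∃ c : ℝ, W.laplacianPinv q *ᵥ (W.laplacian q *ᵥ Φ) = fun i => Φ i - c := by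
  have hn : (n : ℝ) ≠ 0 := by
    have : Nonempty (Fin n) := hW.nonempty
    have : 0 < n := Fin.pos_iff_nonempty.2 this
    positivity
  refine ⟨(∑ i, Φ i) / n, ?_⟩
  rw [← W.laplacian_mulVec_sub_const q Φ ((∑ i, Φ i) / n)]
  refine pinv_laplacian_mulVec hW hq ?_
  simp [Finset.sum_sub_distrib, mul_div_cancel₀ _ hn]

theorem pinv_pos {σ : Fin n → ℝ} (hσ : ∑ i, σ i = 0) (hσ0 : σ ≠ 0) :
    0 < σ ⬝ᵥ (W.laplacianPinv q *ᵥ σ) := by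
  set Ψ := W.laplacianPinv q *ᵥ σ with hΨ
  have h : W.laplacian q *ᵥ Ψ = σ := laplacian_pinv_mulVec hW hq hσ
  have he : σ ⬝ᵥ Ψ = Ψ ⬝ᵥ (W.laplacian q *ᵥ Ψ) := by rw [h, dotProduct_comm]
  rw [he]
  refine lt_of_le_of_ne (W.dotProduct_laplacian_nonneg hq Ψ) fun h0 => hσ0 ?_
  have h2 := eq_of_dotProduct_laplacian_eq_zero hW hq h0.symm
  have : Nonempty (Fin n) := hW.nonempty
  obtain ⟨i₀⟩ := this
  have h3 : Ψ = fun _ => Ψ i₀ := funext fun i => h2 i i₀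
  rw [← h, h3, laplacian_mulVec_const]

/-- Adding the all-ones matrix removes the kernel of constants and turns the pseudo-inverse into a
genuine inverse composed with the projection to mean zero. This formula is rational in `q`, which
yields smoothness of `L(q)†`. -/
theorem laplacianPinv_eq_inv_mul :
    W.laplacianPinv q = (W.laplacian q + Matrix.of fun _ _ => 1)⁻¹ *
      (1 - Matrix.of fun _ _ => (n : ℝ)⁻¹) ∧
    (W.laplacian q + Matrix.of fun _ _ => 1).det ≠ 0 := by
  have hn : (n : ℝ) ≠ 0 := by
    have : Nonempty (Fin n) := hW.nonempty
    have : 0 < n := Fin.pos_iff_nonempty.2 this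
    positivity
  have hJ : ∀ v : Fin n → ℝ, (Matrix.of fun _ _ => 1 : Matrix (Fin n) (Fin n) ℝ) *ᵥ v =
      fun _ => ∑ i, v i := by
    intro v; funext i; simp [Matrix.mulVec, dotProduct]
  have hdet : (W.laplacian q + Matrix.of fun _ _ => 1).det ≠ 0 := by
    intro h
    obtain ⟨v, hv, hv0⟩ := Matrix.exists_mulVec_eq_zero_iff.2 h
    rw [Matrix.add_mulVec, hJ] at hv0
    have hs : ∑ i, v i = 0 := by
      have h1 : ∑ i, (W.laplacian q *ᵥ v + (fun _ => ∑ i, v i) : Fin n → ℝ) i = 0 := by rw [hv0]; simp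
      simp only [Pi.add_apply, Finset.sum_add_distrib, sum_laplacian_mulVec] at h1
      simpa [hn] using h1
    have hL : W.laplacian q *ᵥ v = 0 := by
      rw [hs] at hv0
      funext i
      simpa using congrFun hv0 i
    have := laplacian_pinv_mulVec hW hq hs
    rw [Matrix.mulVec_mulVec, laplacian_mul_pinv_comm, ← Matrix.mulVec_mulVec, hL,
      Matrix.mulVec_zero] at this
    exact hv this.symm
  refine ⟨?_, hdet⟩
  have key : (W.laplacian q + Matrix.of fun _ _ => 1) * W.laplacianPinv q =
      1 - Matrix.of fun _ _ => (n : ℝ)⁻¹ := by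
    refine Matrix.ext_of_mulVec_single fun j => ?_
    rw [← Matrix.mulVec_mulVec, Matrix.add_mulVec, hJ, Matrix.sub_mulVec, Matrix.one_mulVec]
    set e : Fin n → ℝ := Pi.single j 1 with he
    have h1 : W.laplacianPinv q *ᵥ e = W.laplacianPinv q *ᵥ (e - fun _ => (n : ℝ)⁻¹) := by
      rw [Matrix.mulVec_sub, pinv_mulVec_const, sub_zero]
    have h2 : ∑ i, (W.laplacianPinv q *ᵥ e) i = 0 := by
      have := W.dotProduct_pinv_comm q (fun _ => 1) e
      rw [pinv_mulVec_const, dotProduct_zero] at this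
      simpa [dotProduct] using this
    rw [h2, h1, laplacian_pinv_mulVec hW hq (by simp [he, hn])]
    funext i
    simp [he]
  rw [← key, ← mul_assoc, Matrix.nonsing_inv_mul _ hdet.isUnit, one_mul]

omit hq
theorem contDiffOn_laplacianPinv (i j : Fin n) :
    ContDiffOn ℝ ∞ (fun x => W.laplacianPinv x i j) (posOrthant n) := by
  have h : ∀ i j, ContDiffOn ℝ ∞
      (fun x => (((W.laplacian x + Matrix.of fun _ _ => 1)⁻¹ *
        (1 - Matrix.of fun _ _ => (n : ℝ)⁻¹) : Matrix (Fin n) (Fin n) ℝ) i j))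
      (posOrthant n) := by
    refine contDiffOn_matrixMul (contDiffOn_matrixInv (fun i j => ?_)
      fun x hx => (laplacianPinv_eq_inv_mul hW hx).2) fun i j => contDiffOn_const
    simp only [laplacian, Matrix.add_apply, Matrix.sub_apply, Matrix.diagonal_apply,
      Matrix.of_apply]
    split_ifs <;> fun_prop
  exact (h i j).congr fun x hx => by rw [(laplacianPinv_eq_inv_mul hW hx).1]

end WeightedGraph
-- Derivative of the metric and the Christoffel symbol.
namespace WeightedGraph

variable {n : ℕ} (W : WeightedGraph n)

/-- The derivative of the pseudo-inverse `L(q)†` in the direction `w`. -/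
def dPinv (q w : Fin n → ℝ) : Matrix (Fin n) (Fin n) ℝ :=
  Matrix.of fun i j => fderiv ℝ (fun x => W.laplacianPinv x i j) q w

variable {W} (hW : W.graph.Connected) {q : Fin n → ℝ} (hq : q ∈ posOrthant n)

include hW hq

theorem differentiableAt_laplacianPinv (i j : Fin n) :
    DifferentiableAt ℝ (fun x => W.laplacianPinv x i j) q :=
  ((contDiffOn_laplacianPinv hW i j).contDiffAt
    ((isOpen_posOrthant n).mem_nhds hq)).differentiableAt (by simp)

omit hq in
theorem hasDerivAt_laplacianPinv {c : ℝ → Fin n → ℝ} {c' : Fin n → ℝ} {t : ℝ}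
    (hc : HasDerivAt c c' t) (hct : c t ∈ posOrthant n) (i j : Fin n) :
    HasDerivAt (fun t => W.laplacianPinv (c t) i j) (W.dPinv (c t) c' i j) t :=
  (differentiableAt_laplacianPinv hW hct i j).hasFDerivAt.comp_hasDerivAt t hc

theorem fderiv_metric (τ υ w : Fin n → ℝ) :
    fderiv ℝ (fun x => W.metric x τ υ) q w = τ ⬝ᵥ (W.dPinv q w *ᵥ υ) := by
  have hd : DifferentiableAt ℝ (fun x => W.metric x τ υ) q :=
    ((contDiffOn_dotProduct contDiffOn_const (contDiffOn_mulVec (contDiffOn_laplacianPinv hW)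
      contDiffOn_const)).contDiffAt ((isOpen_posOrthant n).mem_nhds hq)).differentiableAt (by simp)
  have h1 := hasDerivAt_comp_line hd w
  have hl : HasDerivAt (fun t : ℝ => q + t • w) w 0 := by
    simpa using ((hasDerivAt_id (0 : ℝ)).smul_const w).const_add q
  have h2 := hasDerivAt_dotProduct (hasDerivAt_const (0 : ℝ) τ) (hasDerivAt_mulVec
    (hasDerivAt_laplacianPinv hW hl (by simpa using hq)) (hasDerivAt_const (0 : ℝ) υ))
  have h3 := h1.unique h2
  simpa using h3

omit hW hq in
theorem dPinv_transpose (w : Fin n → ℝ) : (W.dPinv q w)ᵀ = W.dPinv q w := by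
  ext i j
  simp only [dPinv, Matrix.transpose_apply, Matrix.of_apply]
  congr 2
  funext x
  conv_lhs => rw [← laplacianPinv_transpose, Matrix.transpose_apply]

omit hW hq in
theorem dotProduct_dPinv_comm (w σ τ : Fin n → ℝ) :
    σ ⬝ᵥ (W.dPinv q w *ᵥ τ) = τ ⬝ᵥ (W.dPinv q w *ᵥ σ) := by
  rw [Matrix.dotProduct_mulVec, ← Matrix.mulVec_transpose, dPinv_transpose, dotProduct_comm]

theorem koszul_self (σ υ : Fin n → ℝ) :
    W.koszul q σ σ υ =
      υ ⬝ᵥ (W.dPinv q σ *ᵥ σ) - 1 / 2 * (σ ⬝ᵥ (W.dPinv q υ *ᵥ σ)) := by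
  rw [koszul, fderiv_metric hW hq, fderiv_metric hW hq, dotProduct_dPinv_comm σ σ υ]
  ring

theorem koszul_self_eq_dotProduct (σ υ : Fin n → ℝ) :
    W.koszul q σ σ υ = υ ⬝ᵥ (fun i => W.koszul q σ σ (Pi.single i 1)) := by
  set A : (Fin n → ℝ) →L[ℝ] ℝ := fderiv ℝ (fun x => W.metric x σ σ) q with hA
  have hAυ : ∀ υ, σ ⬝ᵥ (W.dPinv q υ *ᵥ σ) = A υ := fun υ => (fderiv_metric hW hq σ σ υ).symm
  rw [koszul_self hW hq, hAυ, clm_apply_eq_sum A υ]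
  simp only [koszul_self hW hq, hAυ]
  simp only [dotProduct, Finset.mul_sum, ← Finset.sum_sub_distrib, Pi.single_apply, ite_mul,
    one_mul, zero_mul, Finset.sum_ite_eq', Finset.mem_univ, if_true]
  exact Finset.sum_congr rfl fun i _ => by ring

/-- Differentiate `L(q + t w) L(q + t w)† σ = σ` at `t = 0`. The vector `L(q)† σ` differs from `Φ`
by a constant, which `L(w)` kills. -/
theorem laplacian_dPinv (w Φ : Fin n → ℝ) :
    W.laplacian q *ᵥ (W.dPinv q w *ᵥ (W.laplacian q *ᵥ Φ)) = -(W.laplacian w *ᵥ Φ) := by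
  set σ := W.laplacian q *ᵥ Φ with hσ
  have hl : HasDerivAt (fun t : ℝ => q + t • w) w 0 := by
    simpa using ((hasDerivAt_id (0 : ℝ)).smul_const w).const_add q
  have hL : ∀ i j, HasDerivAt (fun t : ℝ => W.laplacian (q + t • w) i j) (W.laplacian w i j) 0 := by
    intro i j
    simp only [laplacian_add_smul]
    simpa using ((hasDerivAt_id (0 : ℝ)).mul_const (W.laplacian w i j)).const_add
      (W.laplacian q i j)
  have h1 := hasDerivAt_mulVec hL (hasDerivAt_mulVec
    (hasDerivAt_laplacianPinv hW hl (by simpa using hq)) (hasDerivAt_const (0 : ℝ) σ))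
  have hev : ∀ᶠ t : ℝ in nhds 0, q + t • w ∈ posOrthant n :=
    hl.continuousAt.eventually_mem ((isOpen_posOrthant n).mem_nhds (by simpa using hq))
  have h2 : HasDerivAt (fun t : ℝ =>
      W.laplacian (q + t • w) *ᵥ (W.laplacianPinv (q + t • w) *ᵥ σ)) 0 0 := by
    refine (hasDerivAt_const (0 : ℝ) σ).congr_of_eventuallyEq (hev.mono fun t ht => ?_)
    exact laplacian_pinv_mulVec hW ht (W.sum_laplacian_mulVec q Φ)
  have h3 := h1.unique h2
  simp only [zero_smul, add_zero, Matrix.mulVec_zero] at h3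
  obtain ⟨c, hc⟩ := exists_pinv_laplacian_mulVec hW hq Φ
  rw [← hσ] at hc
  rw [hc, laplacian_mulVec_sub_const] at h3
  exact eq_neg_of_add_eq_zero_right h3

/-- With `σ = L(q) Φ`, `laplacian_dPinv` turns the Christoffel vector into `-L(σ) Φ + ½ L(q) Γ(Φ,
Φ)`; pairing with `f` and summing by parts gives both `Γ` terms. -/
theorem dotProduct_christoffel (f Φ : Fin n → ℝ) :
    f ⬝ᵥ W.christoffel q (W.velocity q Φ) (W.velocity q Φ) =
      -∑ i, q i * (W.Gam (W.Gam f Φ) Φ i - (1 / 2) * W.Gam (W.Gam Φ Φ) f i) := by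
  rw [← laplacian_mulVec]
  set σ := W.laplacian q *ᵥ Φ with hσ
  have hk : (fun i => W.koszul q σ σ (Pi.single i 1)) =
      W.dPinv q σ *ᵥ σ + (1 / 2 : ℝ) • W.Gam Φ Φ := by
    funext i
    rw [koszul_self hW hq]
    have h1 : σ ⬝ᵥ (W.dPinv q (Pi.single i 1) *ᵥ σ) = - W.Gam Φ Φ i := by
      have h := W.dotProduct_laplacian_comm q Φ (W.dPinv q (Pi.single i 1) *ᵥ σ)
      rw [← hσ, dotProduct_comm _ σ] at h
      rw [← h, hσ, laplacian_dPinv hW hq, dotProduct_neg, dotProduct_laplacian]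
      simp [Pi.single_apply]
    rw [h1]
    simp
  rw [christoffel, hk, Matrix.mulVec_add, Matrix.mulVec_smul]
  conv_lhs => rw [hσ, laplacian_dPinv hW hq, ← hσ]
  -- Two summations by parts: the first makes `σ` the weight of `Γ(f, Φ)`, the second unfolds `σ =
  -- L(q) Φ` against it.
  have h2 : f ⬝ᵥ (W.laplacian σ *ᵥ Φ) = ∑ i, q i * W.Gam (W.Gam f Φ) Φ i := by
    rw [dotProduct_laplacian, ← dotProduct_laplacian W q, ← hσ, dotProduct_comm]
    rfl
  have h3 : f ⬝ᵥ (W.laplacian q *ᵥ W.Gam Φ Φ) = ∑ i, q i * W.Gam (W.Gam Φ Φ) f i := by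
    rw [dotProduct_laplacian, Gam_comm]
  rw [dotProduct_add, dotProduct_neg, dotProduct_smul, h2, h3, smul_eq_mul]
  simp only [mul_sub, Finset.sum_sub_distrib, Finset.mul_sum]
  rw [neg_sub, neg_add_eq_sub]
  congr 1
  exact Finset.sum_congr rfl fun i _ => by ring

/-- This is the defining property of the Levi-Civita connection. Mean zero of `υ` is needed for
`L(q) L(q)† υ = υ`. -/
theorem dotProduct_pinv_christoffel {υ : Fin n → ℝ} (hυ : ∑ i, υ i = 0) (σ : Fin n → ℝ) :
    υ ⬝ᵥ (W.laplacianPinv q *ᵥ W.christoffel q σ σ) = W.koszul q σ σ υ := by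
  rw [dotProduct_pinv_comm, christoffel, dotProduct_comm, dotProduct_laplacian_comm,
    laplacian_pinv_mulVec hW hq hυ, koszul_self_eq_dotProduct hW hq, dotProduct_comm]

end WeightedGraph

/-! ### The pulled back metric and the tangential and normal parts. -/

section Model

variable {n d : ℕ} {U : Set (Fin d → ℝ)} {p : (Fin d → ℝ) → (Fin n → ℝ)}

theorem jacobian_mulVec (x b : Fin d → ℝ) : jacobian p x *ᵥ b = fderiv ℝ p x b :=
  LinearMap.toMatrix'_mulVec _ _

namespace IsStatisticalModel

variable (hp : IsStatisticalModel U p)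
include hp

theorem mem_posOrthant {x : Fin d → ℝ} (hx : x ∈ U) : p x ∈ posOrthant n := (hp.mapsTo hx).1

theorem contDiffAt {x : Fin d → ℝ} (hx : x ∈ U) : ContDiffAt ℝ ∞ p x :=
  hp.contDiffOn.contDiffAt (hp.isOpen.mem_nhds hx)

theorem differentiableAt {x : Fin d → ℝ} (hx : x ∈ U) : DifferentiableAt ℝ p x :=
  (hp.contDiffAt hx).differentiableAt (by simp)

theorem contDiffOn_fderiv : ContDiffOn ℝ ∞ (fderiv ℝ p) U :=
  hp.contDiffOn.fderiv_of_isOpen hp.isOpen (by simp)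

theorem differentiableAt_fderiv {x : Fin d → ℝ} (hx : x ∈ U) :
    DifferentiableAt ℝ (fderiv ℝ p) x :=
  (hp.contDiffOn_fderiv.contDiffAt (hp.isOpen.mem_nhds hx)).differentiableAt (by simp)

theorem contDiffOn_jacobian (i : Fin n) (j : Fin d) :
    ContDiffOn ℝ ∞ (fun x => jacobian p x i j) U := by
  have h : ContDiffOn ℝ ∞ (fun x => fderiv ℝ p x (Pi.single j 1)) U :=
    hp.contDiffOn_fderiv.clm_apply contDiffOn_const
  refine (contDiffOn_pi.1 h i).congr fun x _ => ?_
  rw [← jacobian_mulVec]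
  simp

theorem sum_jacobian_mulVec {x : Fin d → ℝ} (hx : x ∈ U) (b : Fin d → ℝ) :
    ∑ i, (jacobian p x *ᵥ b) i = 0 := by
  have h1 := hasDerivAt_comp_line (hp.differentiableAt hx) b
  have h2 := HasDerivAt.fun_sum fun (i : Fin n) (_ : i ∈ Finset.univ) => hasDerivAt_pi.1 h1 i
  have hl : ContinuousAt (fun t : ℝ => x + t • b) 0 := by fun_prop
  have hev : ∀ᶠ t : ℝ in nhds 0, x + t • b ∈ U :=
    hl.eventually_mem (hp.isOpen.mem_nhds (by simpa using hx))
  have h3 := (hasDerivAt_const (0 : ℝ) (1 : ℝ)).congr_of_eventuallyEq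
    (hev.mono fun t ht => (hp.mapsTo ht).2)
  rw [jacobian_mulVec]
  exact h2.unique h3

theorem jacobian_mulVec_ne_zero {x : Fin d → ℝ} (hx : x ∈ U) {b : Fin d → ℝ} (hb : b ≠ 0) :
    jacobian p x *ᵥ b ≠ 0 := by
  have h := hp.rank_eq x hx
  change (jacobian p x).rank = d at h
  have hinj : Function.Injective (jacobian p x).mulVecLin := by
    rw [← LinearMap.ker_eq_bot, ← Submodule.finrank_eq_zero]
    have := (jacobian p x).mulVecLin.finrank_range_add_finrank_ker
    rw [Module.finrank_fin_fun] at this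
    unfold Matrix.rank at h
    omega
  intro h0
  exact hb (hinj (by simpa using h0))

theorem hasDerivAt_jacobian {x : Fin d → ℝ} (hx : x ∈ U) (a : Fin d → ℝ) (i : Fin n)
    (j : Fin d) :
    HasDerivAt (fun t : ℝ => jacobian p (x + t • a) i j)
      (LinearMap.toMatrix' (fderiv ℝ (fderiv ℝ p) x a : (Fin d → ℝ) →ₗ[ℝ] (Fin n → ℝ)) i j) 0 := by
  have h1 := hasDerivAt_comp_line (hp.differentiableAt_fderiv hx) a
  have h2 := h1.clm_apply (hasDerivAt_const (0 : ℝ) (Pi.single j 1 : Fin d → ℝ))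
  have h3 := hasDerivAt_pi.1 h2 i
  simp only [map_zero, add_zero, LinearMap.toMatrix'_apply, jacobian] at h3 ⊢
  exact h3

variable {W : WeightedGraph n} (hW : W.graph.Connected)

omit hp in
theorem _root_.DiscreteOT.dotProduct_paramMetric (x a b : Fin d → ℝ) :
    a ⬝ᵥ (W.paramMetric p x *ᵥ b) =
      (jacobian p x *ᵥ a) ⬝ᵥ (W.laplacianPinv (p x) *ᵥ (jacobian p x *ᵥ b)) := by
  rw [WeightedGraph.paramMetric, ← Matrix.mulVec_mulVec, ← Matrix.mulVec_mulVec,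
    Matrix.dotProduct_mulVec, Matrix.vecMul_transpose]

include hW

theorem contDiffOn_pinv_comp (i j : Fin n) :
    ContDiffOn ℝ ∞ (fun x => W.laplacianPinv (p x) i j) U :=
  (WeightedGraph.contDiffOn_laplacianPinv hW i j).comp hp.contDiffOn
    fun _ hx => hp.mem_posOrthant hx

theorem isSmoothMetricOn : IsSmoothMetricOn (W.paramMetric p) U where
  isOpen := hp.isOpen
  smooth := contDiffOn_matrixMul (contDiffOn_matrixMul
    (fun i j => hp.contDiffOn_jacobian j i) (hp.contDiffOn_pinv_comp hW)) hp.contDiffOn_jacobian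
  symm x _ := by
    rw [WeightedGraph.paramMetric, Matrix.transpose_mul, Matrix.transpose_mul,
      Matrix.transpose_transpose, W.laplacianPinv_transpose, Matrix.mul_assoc]
  pos x hx a ha := by
    rw [dotProduct_paramMetric]
    exact WeightedGraph.pinv_pos hW (hp.mem_posOrthant hx) (hp.sum_jacobian_mulVec hx a)
      (hp.jacobian_mulVec_ne_zero hx ha)

theorem tangentCoord_jacobian {x : Fin d → ℝ} (hx : x ∈ U) (a : Fin d → ℝ) :
    W.tangentCoord p x (jacobian p x *ᵥ a) = a := by
  rw [WeightedGraph.tangentCoord, Matrix.mulVec_mulVec, Matrix.mul_assoc, Matrix.mul_assoc,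
    ← Matrix.mul_assoc (jacobian p x)ᵀ, ← Matrix.mulVec_mulVec]
  exact (hp.isSmoothMetricOn hW).inv_mulVec hx a

/-- A vector orthogonal to the model is recovered after any tangential shift. In `relaxationHess_eq`
the shift is by the derivative of the velocity coordinates, so the constant-coefficient extension
suffices for `B`. -/
theorem normalPart_eq {x : Fin d → ℝ} (hx : x ∈ U) {w : Fin n → ℝ} (y : Fin d → ℝ)
    (hw : ∀ b, (jacobian p x *ᵥ b) ⬝ᵥ (W.laplacianPinv (p x) *ᵥ w) = 0) :
    W.normalPart p x (w - jacobian p x *ᵥ y) = w := by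
  have h0 : W.tangentCoord p x w = 0 := by
    have : (jacobian p x)ᵀ *ᵥ (W.laplacianPinv (p x) *ᵥ w) = 0 := by
      refine dotProduct_eq_zero_iff.1 fun b => ?_
      rw [dotProduct_comm, Matrix.dotProduct_mulVec, Matrix.vecMul_transpose]
      exact hw b
    rw [WeightedGraph.tangentCoord, ← Matrix.mulVec_mulVec, ← Matrix.mulVec_mulVec, this,
      Matrix.mulVec_zero]
  have h1 : W.tangentCoord p x (w - jacobian p x *ᵥ y) = -y := by
    rw [WeightedGraph.tangentCoord, Matrix.mulVec_sub]
    change W.tangentCoord p x w - W.tangentCoord p x (jacobian p x *ᵥ y) = -y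
    rw [h0, hp.tangentCoord_jacobian hW hx, zero_sub]
  rw [WeightedGraph.normalPart, h1, Matrix.mulVec_neg]
  abel

end IsStatisticalModel

end Model

/-! ### The second derivative of the relaxation along the geodesic flow. -/

/-- The derivative `f ⬝ J(x) G(x)⁻¹ s` of the relaxation of `f` in the direction of the velocity
with momentum `s`. -/
def relaxationDeriv {n d : ℕ} (W : WeightedGraph n) (p : (Fin d → ℝ) → (Fin n → ℝ))
    (f : Fin n → ℝ) (z : (Fin d → ℝ) × (Fin d → ℝ)) : ℝ :=
  f ⬝ᵥ (jacobian p z.1 *ᵥ hamVel (W.paramMetric p) z)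

/-- The second derivative of the relaxation of `f` along the geodesic flow. -/
def relaxationHess {n d : ℕ} (W : WeightedGraph n) (p : (Fin d → ℝ) → (Fin n → ℝ))
    (f : Fin n → ℝ) (z : (Fin d → ℝ) × (Fin d → ℝ)) : ℝ :=
  fderiv ℝ (relaxationDeriv W p f) z
    (hamVel (W.paramMetric p) z, hamForce (W.paramMetric p) z)

/-- An envelope argument: for `s = G(x) a` the sum `sᵀ G(y)⁻¹ s + aᵀ G(y) a` is minimal at `y = x`
by `young_identity`. The two derivatives are thus opposite, and no formula for the derivative of
`G⁻¹` is needed. -/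
theorem IsSmoothMetricOn.hamForce_dotProduct_eq {d : ℕ}
    {G : (Fin d → ℝ) → Matrix (Fin d) (Fin d) ℝ} {U : Set (Fin d → ℝ)}
    (hG : IsSmoothMetricOn G U) {x : Fin d → ℝ} (hx : x ∈ U) (a b : Fin d → ℝ) :
    hamForce G (x, G x *ᵥ a) ⬝ᵥ b = 1 / 2 * fderiv ℝ (fun y => a ⬝ᵥ (G y *ᵥ a)) x b := by
  set s := G x *ᵥ a with hs
  have hd1 := hG.differentiableAt_inv_quadratic hx s
  have hd2 : DifferentiableAt ℝ (fun y => a ⬝ᵥ (G y *ᵥ a)) x :=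
    ((contDiffOn_dotProduct contDiffOn_const
      (contDiffOn_mulVec hG.smooth contDiffOn_const)).contDiffAt
        (hG.isOpen.mem_nhds hx)).differentiableAt (by simp)
  have hmin : IsLocalMin (fun y => s ⬝ᵥ ((G y)⁻¹ *ᵥ s) + a ⬝ᵥ (G y *ᵥ a)) x := by
    filter_upwards [hG.isOpen.mem_nhds hx] with y hy
    have h2 := hG.young_identity hy s a
    have h3 := hG.nonneg hy (a - (G y)⁻¹ *ᵥ s)
    rw [hs, hG.inv_mulVec hx, ← hs, dotProduct_comm a s]
    linarith
  have h0 := hmin.fderiv_eq_zero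
  rw [fderiv_fun_add hd1 hd2] at h0
  have h1 := DFunLike.congr_fun h0 b
  rw [hamForce_dotProduct]
  simp only [add_apply, zero_apply] at h1
  linarith

namespace IsStatisticalModel

variable {n d : ℕ} {U : Set (Fin d → ℝ)} {p : (Fin d → ℝ) → (Fin n → ℝ)}
  (hp : IsStatisticalModel U p) {W : WeightedGraph n} (hW : W.graph.Connected)

include hp

theorem fderiv_fderiv_comm {x : Fin d → ℝ} (hx : x ∈ U) (a b : Fin d → ℝ) :
    fderiv ℝ (fderiv ℝ p) x a b = fderiv ℝ (fderiv ℝ p) x b a :=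
  ((hp.contDiffAt hx).isSymmSndFDerivAt (by
    simpa using (WithTop.coe_le_coe.2 le_top : ((2 : ℕ∞) : ℕ∞ω) ≤ ∞))).eq a b

include hW

theorem contDiffOn_relaxationDeriv (f : Fin n → ℝ) :
    ContDiffOn ℝ ∞ (relaxationDeriv W p f) (U ×ˢ Set.univ) :=
  contDiffOn_dotProduct contDiffOn_const (contDiffOn_mulVec
    (fun i j => (hp.contDiffOn_jacobian i j).comp contDiffOn_fst fun _ hz => hz.1)
    (hp.isSmoothMetricOn hW).contDiffOn_hamVel)

theorem continuousOn_relaxationHess (f : Fin n → ℝ) :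
    ContinuousOn (relaxationHess W p f) (U ×ˢ Set.univ) := by
  have hG := hp.isSmoothMetricOn hW
  exact (((hp.contDiffOn_relaxationDeriv hW f).fderiv_of_isOpen (m := ∞) hG.isOpen_prod
    (by simp)).clm_apply (hG.contDiffOn_hamVel.prodMk hG.contDiffOn_hamForce)).continuousOn

theorem hasDerivAt_metric_line {x : Fin d → ℝ} (hx : x ∈ U) (v : Fin d → ℝ) {u w : ℝ → Fin d → ℝ}
    {u' w' : Fin d → ℝ} (hu : HasDerivAt u u' 0) (hw : HasDerivAt w w' 0) :
    HasDerivAt (fun t : ℝ => u t ⬝ᵥ (W.paramMetric p (x + t • v) *ᵥ w t))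
      ((fderiv ℝ (fderiv ℝ p) x v (u 0) + jacobian p x *ᵥ u') ⬝ᵥ
          (W.laplacianPinv (p x) *ᵥ (jacobian p x *ᵥ w 0)) +
        (jacobian p x *ᵥ u 0) ⬝ᵥ (W.dPinv (p x) (jacobian p x *ᵥ v) *ᵥ (jacobian p x *ᵥ w 0) +
          W.laplacianPinv (p x) *ᵥ (fderiv ℝ (fderiv ℝ p) x v (w 0) + jacobian p x *ᵥ w'))) 0 := by
  simp only [dotProduct_paramMetric]
  have hJ := hp.hasDerivAt_jacobian hx v
  have hc : HasDerivAt (fun t : ℝ => p (x + t • v)) (jacobian p x *ᵥ v) 0 := by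
    rw [jacobian_mulVec]; exact hasDerivAt_comp_line (hp.differentiableAt hx) v
  have hA := WeightedGraph.hasDerivAt_laplacianPinv hW hc
    (by simpa using hp.mem_posOrthant hx)
  have h := hasDerivAt_dotProduct (hasDerivAt_mulVec hJ hu)
    (hasDerivAt_mulVec hA (hasDerivAt_mulVec hJ hw))
  simp only [zero_smul, add_zero, LinearMap.toMatrix'_mulVec] at h
  exact h

/-- In the flat coordinates the acceleration of the image of a geodesic is `D + J Y'`, so `f` pairs
with it to the second derivative. Adding the Christoffel term gives the ambient covariant
acceleration, which `hmain` shows to be normal, hence equal to `B(V, V)`. -/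
theorem relaxationHess_eq {x : Fin d → ℝ} (hx : x ∈ U) (a : Fin d → ℝ) (f Φ : Fin n → ℝ)
    (hΦ : jacobian p x *ᵥ a = W.velocity (p x) Φ) :
    relaxationHess W p f (x, W.paramMetric p x *ᵥ a) =
      ∑ i, p x i * (W.Gam (W.Gam f Φ) Φ i - (1 / 2) * W.Gam (W.Gam Φ Φ) f i) +
        ∑ i, f i * W.secondFundamentalForm p x (W.velocity (p x) Φ) (W.velocity (p x) Φ) i := by
  have hG := hp.isSmoothMetricOn hW
  have hpx := hp.mem_posOrthant hx
  set s := W.paramMetric p x *ᵥ a with hs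
  set z : (Fin d → ℝ) × (Fin d → ℝ) := (x, s) with hz
  have hzU : z ∈ U ×ˢ (Set.univ : Set (Fin d → ℝ)) := ⟨hx, trivial⟩
  have hvel : hamVel (W.paramMetric p) z = a := hG.inv_mulVec hx a
  set σ := hamForce (W.paramMetric p) z with hσ
  set J := jacobian p x with hJ
  set D := fderiv ℝ (fderiv ℝ p) x a a with hD
  -- the velocity along the line `z + t (a, σ)`
  have hdv : DifferentiableAt ℝ (hamVel (W.paramMetric p)) z :=
    (hG.contDiffOn_hamVel.contDiffAt (hG.isOpen_prod.mem_nhds hzU)).differentiableAt (by simp)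
  have hY := hasDerivAt_comp_line hdv (a, σ)
  set Y' := fderiv ℝ (hamVel (W.paramMetric p)) z (a, σ) with hY'
  have hY0 : hamVel (W.paramMetric p) (z + (0 : ℝ) • (a, σ)) = a := by
    rw [zero_smul, add_zero, hvel]
  have hdh : DifferentiableAt ℝ (relaxationDeriv W p f) z :=
    ((hp.contDiffOn_relaxationDeriv hW f).contDiffAt
      (hG.isOpen_prod.mem_nhds hzU)).differentiableAt (by simp)
  have hHess : relaxationHess W p f z = f ⬝ᵥ (D + J *ᵥ Y') := by
    have h1 := hasDerivAt_comp_line hdh (a, σ)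
    have h2 := hasDerivAt_dotProduct (hasDerivAt_const (0 : ℝ) f)
      (hasDerivAt_mulVec (hp.hasDerivAt_jacobian hx a) hY)
    rw [relaxationHess, hvel]
    refine (h1.unique h2).trans ?_
    rw [hY0]
    simp only [zero_dotProduct, zero_add, LinearMap.toMatrix'_mulVec, zero_smul, add_zero]
    rfl
  set V := J *ᵥ a with hV
  -- Normality is the geodesic equation tested against `b`: differentiate the momentum `bᵀ G Y` once
  -- by the product rule and once as `b ⬝ (s + t σ)`, then compare with the Koszul formula. Symmetry
  -- of the second derivative of `p` cancels the remaining term.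
  have hmain : ∀ b, (J *ᵥ b) ⬝ᵥ (W.laplacianPinv (p x) *ᵥ
      (D + J *ᵥ Y' + W.christoffel (p x) V V)) = 0 := by
    intro b
    have h1 := hp.hasDerivAt_metric_line hW hx a (hasDerivAt_const (0 : ℝ) b) hY
    have h2 : HasDerivAt (fun t : ℝ => b ⬝ᵥ (W.paramMetric p (x + t • a) *ᵥ
        hamVel (W.paramMetric p) (z + t • (a, σ)))) (b ⬝ᵥ σ) 0 := by
      have hl : HasDerivAt (fun t : ℝ => s + t • σ) σ 0 := by
        simpa using ((hasDerivAt_id (0 : ℝ)).smul_const σ).const_add s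
      have h3 := hasDerivAt_dotProduct (hasDerivAt_const (0 : ℝ) b) hl
      rw [zero_dotProduct, zero_add] at h3
      have hlc : ContinuousAt (fun t : ℝ => x + t • a) 0 := by fun_prop
      have hev : ∀ᶠ t : ℝ in nhds 0, x + t • a ∈ U :=
        hlc.eventually_mem (hp.isOpen.mem_nhds (by simpa using hx))
      refine h3.congr_of_eventuallyEq (hev.mono fun t ht => ?_)
      exact congrArg (b ⬝ᵥ ·) (hG.mulVec_inv ht (s + t • σ))
    have h4 := h1.unique h2
    have h5 : b ⬝ᵥ σ = fderiv ℝ (fderiv ℝ p) x a b ⬝ᵥ (W.laplacianPinv (p x) *ᵥ V) +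
        1 / 2 * (V ⬝ᵥ (W.dPinv (p x) (J *ᵥ b) *ᵥ V)) := by
      have h6 := hp.hasDerivAt_metric_line hW hx b (hasDerivAt_const (0 : ℝ) a)
        (hasDerivAt_const (0 : ℝ) a)
      have hd2 : DifferentiableAt ℝ (fun y => a ⬝ᵥ (W.paramMetric p y *ᵥ a)) x :=
        ((contDiffOn_dotProduct contDiffOn_const
          (contDiffOn_mulVec hG.smooth contDiffOn_const)).contDiffAt
            (hG.isOpen.mem_nhds hx)).differentiableAt (by simp)
      have h7 := (hasDerivAt_comp_line hd2 b).unique h6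
      rw [dotProduct_comm, hσ, hz, hs, hG.hamForce_dotProduct_eq hx, h7, Matrix.mulVec_zero,
        add_zero, hp.fderiv_fderiv_comm hx b a, dotProduct_add,
        W.dotProduct_pinv_comm _ (jacobian p x *ᵥ a)]
      ring
    rw [h5, hY0, Matrix.mulVec_zero, add_zero, dotProduct_add] at h4
    rw [Matrix.mulVec_add, dotProduct_add, WeightedGraph.dotProduct_pinv_christoffel hW hpx
      (hp.sum_jacobian_mulVec hx b), WeightedGraph.koszul_self hW hpx]
    linarith
  have hB : W.secondFundamentalForm p x V V = D + J *ᵥ Y' + W.christoffel (p x) V V := by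
    rw [← hp.normalPart_eq hW hx Y' hmain, WeightedGraph.secondFundamentalForm, hV,
      hp.tangentCoord_jacobian hW hx, WeightedGraph.covDeriv]
    congr 1
    have hDa : fderiv ℝ (fun y => jacobian p y *ᵥ a) x a = D := by
      simp only [jacobian_mulVec]
      rw [fderiv_clm_apply (hp.differentiableAt_fderiv hx) (differentiableAt_const a)]
      simp [hD]
    rw [hDa]
    abel
  have hC := WeightedGraph.dotProduct_christoffel hW hpx f Φ
  rw [← hΦ] at hC ⊢
  change _ = _ + f ⬝ᵥ W.secondFundamentalForm p x V V
  rw [hHess, hB, dotProduct_add f _ (W.christoffel _ _ _), hC]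
  ring

end IsStatisticalModel

/-! ### The two implications. -/

theorem hasDerivWithinAt_const_mul (c t : ℝ) (I : Set ℝ) :
    HasDerivWithinAt (fun t : ℝ => c * t) c I t :=
  (((hasDerivAt_id t).const_mul c).congr_deriv (by simp)).hasDerivWithinAt

theorem hasDerivWithinAt_half_mul_sq (c t : ℝ) (I : Set ℝ) :
    HasDerivWithinAt (fun t : ℝ => c / 2 * t ^ 2) (c * t) I t :=
  (((hasDerivAt_pow 2 t).const_mul (c / 2)).congr_deriv (by simp; ring)).hasDerivWithinAt

namespace IsSmoothMetricOn

variable {d : ℕ} {G : (Fin d → ℝ) → Matrix (Fin d) (Fin d) ℝ} {U : Set (Fin d → ℝ)}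
  (hG : IsSmoothMetricOn G U)

/-- Quadratic homogeneity in the momentum: this is what makes the rescaled curve `(x(ε t), ε s(ε
t))` solve the flow equations again. -/
theorem _root_.DiscreteOT.hamForce_smul (x s : Fin d → ℝ) (c : ℝ) :
    hamForce G (x, c • s) = c ^ 2 • hamForce G (x, s) := by
  funext k
  have h : (fun y => (c • s) ⬝ᵥ ((G y)⁻¹ *ᵥ (c • s))) =
      (c ^ 2) • fun y => s ⬝ᵥ ((G y)⁻¹ *ᵥ s) := by
    funext y
    simp only [Matrix.mulVec_smul, smul_dotProduct, dotProduct_smul, smul_eq_mul, Pi.smul_apply]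
    ring
  simp only [hamForce, Pi.smul_apply, h]
  rw [fderiv_const_smul_field, Pi.smul_apply, smul_apply, smul_eq_mul, smul_eq_mul]
  ring

include hG

theorem contDiffOn_and_action_of_flow {z : ℝ → (Fin d → ℝ) × (Fin d → ℝ)}
    (hz : ∀ t ∈ Set.Icc (0 : ℝ) 1,
      HasDerivWithinAt z (hamVel G (z t), hamForce G (z t)) (Set.Icc 0 1) t)
    (hU : ∀ t ∈ Set.Icc (0 : ℝ) 1, (z t).1 ∈ U) :
    ContDiffOn ℝ 1 (fun t => (z t).1) (Set.Icc 0 1) ∧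
      metricAction G (fun t => (z t).1) = 2 * ham G (z 0) := by
  have hx : ∀ t ∈ Set.Icc (0 : ℝ) 1,
      HasDerivWithinAt (fun t => (z t).1) (hamVel G (z t)) (Set.Icc 0 1) t :=
    fun t ht => (hz t ht).fst
  have hu := uniqueDiffOn_Icc (zero_lt_one' ℝ)
  have hd : ∀ t ∈ Set.Icc (0 : ℝ) 1,
      derivWithin (fun t => (z t).1) (Set.Icc 0 1) t = hamVel G (z t) :=
    fun t ht => (hx t ht).derivWithin (hu t ht)
  constructor
  · rw [contDiffOn_one_iff_derivWithin hu]
    refine ⟨fun t ht => (hx t ht).differentiableWithinAt, ContinuousOn.congr ?_ hd⟩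
    exact hG.contDiffOn_hamVel.continuousOn.comp
      (fun t ht => (hz t ht).continuousWithinAt) fun t ht => ⟨hU t ht, trivial⟩
  · have h : Set.EqOn (fun t => derivWithin (fun t => (z t).1) (Set.Icc 0 1) t ⬝ᵥ
        (G (z t).1 *ᵥ derivWithin (fun t => (z t).1) (Set.Icc 0 1) t))
        (fun _ => 2 * ham G (z 0)) (Set.uIcc (0 : ℝ) 1) := by
      intro t ht
      rw [Set.uIcc_of_le zero_le_one] at ht
      simp only
      rw [hd t ht, ← hG.two_mul_ham_eq (hU t ht), hG.ham_eq_of_flow hz hU t ht]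
    rw [metricAction, intervalIntegral.integral_congr h]
    simp

end IsSmoothMetricOn

namespace IsStatisticalModel

variable {n d : ℕ} {U : Set (Fin d → ℝ)} {p : (Fin d → ℝ) → (Fin n → ℝ)}
  (hp : IsStatisticalModel U p) {W : WeightedGraph n} (hW : W.graph.Connected)

include hp hW

theorem paramMetric_self {x : Fin d → ℝ} (hx : x ∈ U) {a : Fin d → ℝ} {Φ : Fin n → ℝ}
    (hΦ : jacobian p x *ᵥ a = W.velocity (p x) Φ) :
    a ⬝ᵥ (W.paramMetric p x *ᵥ a) = ∑ i, W.Gam Φ Φ i * p x i := by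
  rw [dotProduct_paramMetric, hΦ, ← W.laplacian_mulVec]
  obtain ⟨c, hc⟩ :=
    WeightedGraph.exists_pinv_laplacian_mulVec hW (hp.mem_posOrthant hx) Φ
  rw [hc, dotProduct_comm, W.dotProduct_laplacian_comm, W.laplacian_mulVec_sub_const,
    W.dotProduct_laplacian]
  exact Finset.sum_congr rfl fun i _ => mul_comm _ _

/-- Potentials and parameter velocities correspond: `J a` has mean zero, so `L(p)† J a` is a
potential for it, and conversely a tangent `V_Φ` is some `J a`. -/
theorem criterion_iff {x : Fin d → ℝ} (hx : x ∈ U) (f : Fin n → ℝ) (lam : ℝ) :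
    (∀ Φ : Fin n → ℝ, W.velocity (p x) Φ ∈ modelTangentSpace p x →
      lam * ∑ i, W.Gam Φ Φ i * p x i ≤
        ∑ i, p x i * (W.Gam (W.Gam f Φ) Φ i - (1 / 2) * W.Gam (W.Gam Φ Φ) f i) +
          ∑ i, f i * W.secondFundamentalForm p x (W.velocity (p x) Φ) (W.velocity (p x) Φ) i) ↔
    ∀ a : Fin d → ℝ, lam * (a ⬝ᵥ (W.paramMetric p x *ᵥ a)) ≤
      relaxationHess W p f (x, W.paramMetric p x *ᵥ a) := by
  constructor
  · intro h a
    set Φ := W.laplacianPinv (p x) *ᵥ (jacobian p x *ᵥ a) with hΦdef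
    have hΦ : jacobian p x *ᵥ a = W.velocity (p x) Φ := by
      rw [← W.laplacian_mulVec, hΦdef, WeightedGraph.laplacian_pinv_mulVec hW
        (hp.mem_posOrthant hx) (hp.sum_jacobian_mulVec hx a)]
    rw [hp.paramMetric_self hW hx hΦ, hp.relaxationHess_eq hW hx a f Φ hΦ]
    exact h Φ ⟨a, by rw [← hΦ, jacobian_mulVec]; rfl⟩
  · rintro h Φ ⟨a, ha⟩
    have hΦ : jacobian p x *ᵥ a = W.velocity (p x) Φ := by rw [jacobian_mulVec]; exact ha
    have := h a
    rwa [hp.paramMetric_self hW hx hΦ, hp.relaxationHess_eq hW hx a f Φ hΦ] at this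

omit hW in
theorem hasDerivWithinAt_relaxation {z : ℝ → (Fin d → ℝ) × (Fin d → ℝ)} {t : ℝ} {I : Set ℝ}
    (f : Fin n → ℝ) (ht : (z t).1 ∈ U) {F : Fin d → ℝ}
    (hz : HasDerivWithinAt z (hamVel (W.paramMetric p) (z t), F) I t) :
    HasDerivWithinAt (fun t => relaxation p f (z t).1) (relaxationDeriv W p f (z t)) I t := by
  have h1 : HasDerivWithinAt (fun t => p (z t).1)
      (fderiv ℝ p (z t).1 (hamVel (W.paramMetric p) (z t))) I t :=
    (hp.differentiableAt ht).hasFDerivAt.comp_hasDerivWithinAt t hz.fst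
  have h2 := hasDerivWithinAt_dotProduct (hasDerivWithinAt_const t I f) h1
  rw [zero_dotProduct, zero_add, ← jacobian_mulVec] at h2
  exact h2

theorem hasDerivWithinAt_relaxationDeriv {z : ℝ → (Fin d → ℝ) × (Fin d → ℝ)} {t : ℝ}
    {I : Set ℝ} (f : Fin n → ℝ) (ht : (z t).1 ∈ U)
    (hz : HasDerivWithinAt z
      (hamVel (W.paramMetric p) (z t), hamForce (W.paramMetric p) (z t)) I t) :
    HasDerivWithinAt (fun t => relaxationDeriv W p f (z t)) (relaxationHess W p f (z t)) I t :=
  (((hp.contDiffOn_relaxationDeriv hW f).contDiffAt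
    ((hp.isOpen.prod isOpen_univ).mem_nhds ⟨ht, trivial⟩)).differentiableAt
      (by simp)).hasFDerivAt.comp_hasDerivWithinAt t hz

theorem isDisplacementConvex_of_hess {Θ : Set (Fin d → ℝ)} (hΘU : Θ ⊆ U) (f : Fin n → ℝ)
    (lam : ℝ) (h : ∀ x ∈ Θ, ∀ a : Fin d → ℝ, lam * (a ⬝ᵥ (W.paramMetric p x *ᵥ a)) ≤
      relaxationHess W p f (x, W.paramMetric p x *ᵥ a)) :
    W.IsDisplacementConvex p Θ lam (relaxation p f) := by
  rintro γ ⟨⟨hγΘ, S, hS⟩, hmin⟩ t ht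
  have hG := hp.isSmoothMetricOn hW
  set z : ℝ → (Fin d → ℝ) × (Fin d → ℝ) := fun t => (γ t, S t) with hzdef
  have hz : ∀ t ∈ Set.Icc (0 : ℝ) 1, HasDerivWithinAt z
      (hamVel (W.paramMetric p) (z t), hamForce (W.paramMetric p) (z t)) (Set.Icc 0 1) t :=
    fun t ht => (hS t ht).1.prodMk (hS t ht).2
  have hU : ∀ t ∈ Set.Icc (0 : ℝ) 1, (z t).1 ∈ U := fun t ht => hΘU (hγΘ ht)
  have hact : W.action p γ = 2 * ham (W.paramMetric p) (z 0) :=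
    (hG.contDiffOn_and_action_of_flow hz hU).2
  rw [← hmin, hact]
  -- `2 * ham` is the constant squared speed, hence the action, hence the squared distance.
  -- Minimality is used only here.
  set μ := lam * (2 * ham (W.paramMetric p) (z 0)) with hμ
  have hHess : ∀ t ∈ Set.Icc (0 : ℝ) 1, μ ≤ relaxationHess W p f (z t) := by
    intro t ht
    have h1 := h (z t).1 (hγΘ ht) (hamVel (W.paramMetric p) (z t))
    rw [← hG.two_mul_ham_eq (hU t ht), hG.ham_eq_of_flow hz hU t ht, hamVel,
      hG.mulVec_inv (hU t ht)] at h1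
    exact h1
  have hconv : ConvexOn ℝ (Set.Icc (0 : ℝ) 1)
      (fun t => relaxation p f (z t).1 - μ / 2 * t ^ 2) := by
    refine convexOn_of_hasDerivWithinAt2_nonneg (convex_Icc 0 1)
      (f' := fun t => relaxationDeriv W p f (z t) - μ * t)
      (f'' := fun t => relaxationHess W p f (z t) - μ)
      (fun t ht => ((hp.hasDerivWithinAt_relaxation f (hU t ht) (hz t ht)).sub
        (hasDerivWithinAt_half_mul_sq μ t _)).continuousWithinAt)
      (fun t ht => ((hp.hasDerivWithinAt_relaxation f (hU t (interior_subset ht))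
        (hz t (interior_subset ht))).sub (hasDerivWithinAt_half_mul_sq μ t _)).mono interior_subset)
      (fun t ht => ((hp.hasDerivWithinAt_relaxationDeriv hW f (hU t (interior_subset ht))
        (hz t (interior_subset ht))).sub (hasDerivWithinAt_const_mul μ t _)).mono interior_subset)
      (fun t ht => sub_nonneg.2 (hHess t (interior_subset ht)))
  have h1 := hconv.2 (Set.left_mem_Icc.2 zero_le_one) (Set.right_mem_Icc.2 zero_le_one)
    (sub_nonneg.2 ht.2) ht.1 (by ring)
  simp only [smul_eq_mul, mul_zero, mul_one, zero_add] at h1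
  change relaxation p f (z t).1 ≤ (1 - t) * relaxation p f (z 0).1 + t * relaxation p f (z 1).1 - _
  have h2 : lam / 2 * t * (1 - t) * (2 * ham (W.paramMetric p) (z 0)) =
    μ / 2 * t * (1 - t) := by rw [hμ]; ring
  rw [h2]
  nlinarith [h1]

theorem hess_of_isDisplacementConvex_of_mem_interior {Θ : Set (Fin d → ℝ)} (hΘU : Θ ⊆ U)
    (f : Fin n → ℝ) (lam : ℝ) (h : W.IsDisplacementConvex p Θ lam (relaxation p f))
    {x : Fin d → ℝ} (hx : x ∈ interior Θ) (a : Fin d → ℝ) :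
    lam * (a ⬝ᵥ (W.paramMetric p x *ᵥ a)) ≤
      relaxationHess W p f (x, W.paramMetric p x *ᵥ a) := by
  have hG := hp.isSmoothMetricOn hW
  have hxU : x ∈ U := hΘU (interior_subset hx)
  by_contra hlt
  rw [not_le] at hlt
  -- The gap leaves room for the Hessian to vary: by continuity it stays below `ν` along a short
  -- piece of the geodesic, while `ν` stays below `lam * q`.
  obtain ⟨ν, hν1, hν2⟩ := exists_between hlt
  obtain ⟨δ, hδ, z, hz0, hz, hmin⟩ := hG.exists_minimizing_flow hΘU hx a
  have hcz : ContinuousAt z 0 := (hz 0 ⟨by linarith, hδ⟩).1.continuousAt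
  have hcH : ContinuousAt (fun t => relaxationHess W p f (z t)) 0 := by
    refine ContinuousAt.comp (f := z) (g := relaxationHess W p f) ?_ hcz
    rw [hz0]
    exact (hp.continuousOn_relaxationHess hW f).continuousAt
      (hG.isOpen_prod.mem_nhds ⟨hxU, trivial⟩)
  have hev : ∀ᶠ t in nhds (0 : ℝ), relaxationHess W p f (z t) < ν :=
    hcH.eventually_lt_const (by simpa [hz0] using hν1)
  obtain ⟨η, hη, hball⟩ := Metric.eventually_nhds_iff.1 hev
  set ε := min δ η / 2 with hε
  have hεpos : 0 < ε := by positivity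
  have hεδ : ε < δ := by
    have := min_le_left δ η; have : 0 < min δ η := lt_min hδ hη; linarith
  have hεη : ε < η := by
    have := min_le_right δ η; have : 0 < min δ η := lt_min hδ hη; linarith
  have hzε : ∀ t ∈ Set.Icc 0 ε, HasDerivAt z
      (hamVel (W.paramMetric p) (z t), hamForce (W.paramMetric p) (z t)) t ∧
        (z t).1 ∈ interior Θ := fun t ht => hz t ⟨by linarith [ht.1], ht.2.trans_lt hεδ⟩
  have hHess : ∀ t ∈ Set.Icc 0 ε, relaxationHess W p f (z t) ≤ ν := fun t ht =>
    (hball (by rw [Real.dist_eq, sub_zero, abs_of_nonneg ht.1]; exact ht.2.trans_lt hεη)).le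
  set q := a ⬝ᵥ (W.paramMetric p x *ᵥ a) with hq
  -- the rescaled geodesic
  set Z : ℝ → (Fin d → ℝ) × (Fin d → ℝ) := fun t => ((z (ε * t)).1, ε • (z (ε * t)).2) with hZdef
  have hεt : ∀ t ∈ Set.Icc (0 : ℝ) 1, ε * t ∈ Set.Icc 0 ε := fun t ht =>
    ⟨mul_nonneg hεpos.le ht.1, mul_le_of_le_one_right hεpos.le ht.2⟩
  have hZ : ∀ t ∈ Set.Icc (0 : ℝ) 1, HasDerivWithinAt Z
      (hamVel (W.paramMetric p) (Z t), hamForce (W.paramMetric p) (Z t)) (Set.Icc 0 1) t := by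
    intro t ht
    have hlin : HasDerivAt (fun t : ℝ => ε * t) ε t := by
      simpa using (hasDerivAt_id t).const_mul ε
    have h2 := (hzε _ (hεt t ht)).1.scomp t hlin
    have h3 : HasDerivAt (fun t => (z (ε * t)).1)
      (ε • hamVel (W.paramMetric p) (z (ε * t))) t := h2.fst
    have h4 : HasDerivAt (fun t => (z (ε * t)).2)
      (ε • hamForce (W.paramMetric p) (z (ε * t))) t := h2.snd
    have h5 := (h3.prodMk (h4.const_smul ε)).hasDerivWithinAt (s := Set.Icc (0 : ℝ) 1)
    refine h5.congr_deriv (Prod.ext ?_ ?_)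
    · simp only [hamVel, hZdef, Matrix.mulVec_smul]
    · simp only [hZdef]
      rw [hamForce_smul, smul_smul, sq]
  have hZΘ : ∀ t ∈ Set.Icc (0 : ℝ) 1, (Z t).1 ∈ Θ := fun t ht =>
    interior_subset (hzε _ (hεt t ht)).2
  obtain ⟨hC1, hact⟩ := hG.contDiffOn_and_action_of_flow hZ fun t ht => hΘU (hZΘ t ht)
  have hZ0 : (Z 0).1 = x := by simp [hZdef, hz0]
  have hZ1 : (Z 1).1 = (z ε).1 := by simp [hZdef]
  have hE : 2 * ham (W.paramMetric p) (Z 0) = ε ^ 2 * q := by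
    simp only [hZdef, mul_zero, hz0, ham, Matrix.mulVec_smul, smul_dotProduct, dotProduct_smul,
      smul_eq_mul]
    rw [hG.inv_mulVec hxU, dotProduct_comm _ a]
    ring
  rw [hE] at hact
  have hdist : W.distSq p Θ (Z 0).1 (Z 1).1 = ε ^ 2 * q := by
    refine IsLeast.csInf_eq ⟨⟨fun t => (Z t).1, hC1, hZΘ, rfl, rfl, hact.symm⟩, ?_⟩
    rintro e ⟨c, hc, hcΘ, hc0, hc1, rfl⟩
    exact hmin ε ⟨hεpos, hεδ⟩ c hc hcΘ (hc0.trans hZ0) (hc1.trans hZ1)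
  have hgeo : W.IsMinimizingGeodesic p Θ (fun t => (Z t).1) :=
    ⟨⟨hZΘ, fun t => (Z t).2, fun t ht => ⟨(hZ t ht).fst, (hZ t ht).snd⟩⟩, hact.trans hdist.symm⟩
  have hdisp := h _ hgeo (1 / 2) ⟨by norm_num, by norm_num⟩
  rw [hdist] at hdisp
  have hZh : (Z (1 / 2)).1 = (z (ε / 2)).1 := by
    simp only [hZdef]; congr 2; ring
  rw [hZh, hZ0, hZ1] at hdisp
  -- At the midpoint this convexity bounds the relaxation below by the mean of its end values minus
  -- `ν ε² / 8`, whereas `hdisp` bounds it above by that mean minus `lam q ε² / 8`. Together they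
  -- contradict `ν < lam * q`.
  have hconv : ConvexOn ℝ (Set.Icc 0 ε) (fun t => ν / 2 * t ^ 2 - relaxation p f (z t).1) := by
    have hU : ∀ t ∈ Set.Icc 0 ε, (z t).1 ∈ U := fun t ht => hΘU (interior_subset (hzε t ht).2)
    refine convexOn_of_hasDerivWithinAt2_nonneg (convex_Icc 0 ε)
      (f' := fun t => ν * t - relaxationDeriv W p f (z t))
      (f'' := fun t => ν - relaxationHess W p f (z t))
      (fun t ht => ((hasDerivWithinAt_half_mul_sq ν t _).sub (hp.hasDerivWithinAt_relaxation f (hU t ht)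
        (hzε t ht).1.hasDerivWithinAt)).continuousWithinAt)
      (fun t ht => (hasDerivWithinAt_half_mul_sq ν t _).sub (hp.hasDerivWithinAt_relaxation f
        (hU t (interior_subset ht)) (hzε t (interior_subset ht)).1.hasDerivWithinAt))
      (fun t ht => (hasDerivWithinAt_const_mul ν t _).sub (hp.hasDerivWithinAt_relaxationDeriv hW f
        (hU t (interior_subset ht)) (hzε t (interior_subset ht)).1.hasDerivWithinAt))
      (fun t ht => sub_nonneg.2 (hHess t (interior_subset ht)))
  have hmid := hconv.2 (Set.left_mem_Icc.2 hεpos.le) (Set.right_mem_Icc.2 hεpos.le)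
    (by norm_num : (0 : ℝ) ≤ 1 / 2) (by norm_num : (0 : ℝ) ≤ 1 / 2) (by norm_num)
  have hm : (1 / 2 : ℝ) • (0 : ℝ) + (1 / 2 : ℝ) • ε = ε / 2 := by
    simp only [smul_eq_mul]; ring
  rw [hm] at hmid
  simp only [smul_eq_mul] at hmid
  have hz0x : (z 0).1 = x := by rw [hz0]
  rw [hz0x] at hmid
  have hpos : 0 < ε ^ 2 * (lam * q - ν) := mul_pos (by positivity) (sub_pos.2 hν2)
  nlinarith [hmid, hdisp, hpos]

theorem hess_of_isDisplacementConvex {Θ : Set (Fin d → ℝ)} (hΘU : Θ ⊆ U)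
    (hΘ : Θ ⊆ closure (interior Θ)) (f : Fin n → ℝ) (lam : ℝ)
    (h : W.IsDisplacementConvex p Θ lam (relaxation p f)) {x : Fin d → ℝ} (hx : x ∈ Θ)
    (a : Fin d → ℝ) :
    lam * (a ⬝ᵥ (W.paramMetric p x *ᵥ a)) ≤
      relaxationHess W p f (x, W.paramMetric p x *ᵥ a) := by
  have hG := hp.isSmoothMetricOn hW
  have hGa : ContinuousOn (fun y => W.paramMetric p y *ᵥ a) U :=
    (contDiffOn_mulVec hG.smooth contDiffOn_const).continuousOn
  have hx' : U ∈ nhds x := hp.isOpen.mem_nhds (hΘU hx)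
  have h1 : ContinuousAt (fun y => lam * (a ⬝ᵥ (W.paramMetric p y *ᵥ a))) x :=
    (contDiffOn_const.mul (contDiffOn_dotProduct contDiffOn_const
      (contDiffOn_mulVec hG.smooth contDiffOn_const))).continuousOn.continuousAt hx'
  have h2 : ContinuousAt (fun y => relaxationHess W p f (y, W.paramMetric p y *ᵥ a)) x :=
    ((hp.continuousOn_relaxationHess hW f).comp (continuousOn_id.prodMk hGa)
      fun y hy => ⟨hy, trivial⟩).continuousAt hx'
  -- For fixed `a` both sides are continuous in the base point, so a failure at `x` persists at
  -- nearby interior points.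
  by_contra hlt
  rw [not_le] at hlt
  obtain ⟨y, hy, hyΘ⟩ := ((mem_closure_iff_frequently.1 (hΘ hx)).and_eventually
    (h2.eventually_lt h1 hlt)).exists
  exact absurd (hp.hess_of_isDisplacementConvex_of_mem_interior hW hΘU f lam h hy a)
    (not_le.2 hyΘ)

end IsStatisticalModel
end DiscreteOT

end

theorem mainTheorem2 {n d : ℕ} (W : DiscreteOT.WeightedGraph n) (hW : W.graph.Connected)
    (U : Set (Fin d → ℝ)) (p : (Fin d → ℝ) → (Fin n → ℝ))
    (hp : DiscreteOT.IsStatisticalModel U p)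
    (Θ : Set (Fin d → ℝ)) (hΘU : Θ ⊆ U) (hΘ : Θ ⊆ closure (interior Θ))
    (f : Fin n → ℝ) (lam : ℝ) :
    W.IsDisplacementConvex p Θ lam (DiscreteOT.relaxation p f) ↔
      ∀ θ ∈ Θ, ∀ Φ : Fin n → ℝ,
        W.velocity (p θ) Φ ∈ DiscreteOT.modelTangentSpace p θ →
          lam * ∑ i, W.Gam Φ Φ i * p θ i ≤
            ∑ i, p θ i * (W.Gam (W.Gam f Φ) Φ i - (1 / 2) * W.Gam (W.Gam Φ Φ) f i) +
            ∑ i, f i * W.secondFundamentalForm p θ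
              (W.velocity (p θ) Φ) (W.velocity (p θ) Φ) i := by
  constructor
  · intro h θ hθ
    exact (hp.criterion_iff hW (hΘU hθ) f lam).2 fun a =>
      hp.hess_of_isDisplacementConvex hW hΘU hΘ f lam h hθ a
  · intro h
    exact hp.isDisplacementConvex_of_hess hW hΘU f lam fun x hx =>
      (hp.criterion_iff hW (hΘU hx) f lam).1 (h x hx)
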